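/- Strings are finite sequences of symbols, where symbols are natural numbers. For strings $X,Y$ write $X\subseteq Y$ if $X$ is a (not necessarily contiguous) subsequence of $Y$. A string $S$ is a common supersequence of $A$ and $B$ if $A\subseteq S$ and $B\subseteq S$; it is a minimal common supersequence if in addition no proper subsequence of $S$ is a common supersequence of $A$ and $B$. The machine model is a deterministic unit-cost random access machine: a fixed finite program with finitely many registers and a memory of words with indirect addressing; each step is one instruction (load a constant, copy, $+$, truncated $-$, $\times$, memory read, memory write), one test ($=$ or $<$) or sequencing step of its control flow, the writing of one symbol to a write-only output, or the reporting of the string just written. The memory initially holds $|A|$, $|B|$, and the symbols of $A$ and $B$, one per cell, followed by zeros, and the registers initially hold $0$. **Theorem.** There are a program $P$ and a constant $C$ such that for all strings $A$ and $B$, with $n=|A|+|B|$, the program $P$ on input $(A,B)$ halts after having reported every minimal common supersequence of $A$ and $B$ exactly once and no other string (and without leaving a string partly written), and moreover: 1. (preprocessing) there is a preprocessing phase of at most $C(n+1)^3$ steps, in which nothing is written to the output; 2. (delay) from any moment after the preprocessing phase, within at most $C(n+1)$ steps either the next string has been reported or the machine has halted; so $C(n+1)$ bounds the time from the end of the preprocessing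 to the first report, between two consecutive reports, and from the last report to halting; 3. (space) during the whole run only the first $C(n+1)^2$ memory cells are accessed; 4. (word size) at all times every register and memory cell contains either a symbol of the input or a number less than $(n+2)^C$, that is, an integer of $O(\log n)$ bits. In short: the minimal common supersequences of two strings can be enumerated without repetition with $O(n^3)$ preprocessing time, $O(n^2)$ space and $O(n)$ delay. -/

import Mathlib

/-- `S` is a common supersequence of `A` and `B` (`<+` is the subsequence relation). -/
def IsCommonSupersequence {α : Type*} (A B S : List α) : Prop :=
  A.Sublist S ∧ B.Sublist S

/-- `S` is a minimal common supersequence of `A` and `B`: a common supersequence no proper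
subsequence of which is still a common supersequence. -/
def IsMinimalCommonSupersequence {α : Type*} (A B S : List α) : Prop :=
  IsCommonSupersequence A B S ∧
    ∀ T : List α, T.Sublist S → T ≠ S → ¬ IsCommonSupersequence A B T

/-! A random access machine with a write-only output, one step per instruction and per
branching decision. Registers and memory cells hold natural numbers; the growth of these numbers
is bounded separately, by `WordsWithin`. -/

namespace WordRAM

/-- Instructions. The arguments are numbers of registers, except for the literal `k`. -/
inductive Instr
  /-- `r := k` -/
  | const (r k : ℕ)
  /-- `r := a` -/
  | move (r a : ℕ)
  /-- `r := a + b` -/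
  | add (r a b : ℕ)
  /-- `r := a - b`, truncated at `0` -/
  | sub (r a b : ℕ)
  /-- `r := a * b` -/
  | mul (r a b : ℕ)
  /-- `r := mem[a]` -/
  | load (r a : ℕ)
  /-- `mem[a] := b` -/
  | store (a b : ℕ)
  /-- append the symbol in register `a` to the string that is being written -/
  | emit (a : ℕ)
  /-- finish the string that is being written: it is now the next string of the output -/
  | report

/-- Tests: comparisons of two registers. -/
inductive Test
  | eq (a b : ℕ)
  | lt (a b : ℕ)

/-- Programs: finite texts with structured control flow and without recursion. -/
inductive Prog
  | instr (i : Instr)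
  | seq (p q : Prog)
  | cond (b : Test) (p q : Prog)
  | loop (b : Test) (p : Prog)

/-- The data of a machine: registers, memory, the string that is being written, and the list of
the strings that have been reported so far, in the order of their reports. -/
structure State where
  reg : ℕ → ℕ
  mem : ℕ → ℕ
  cur : List ℕ
  out : List (List ℕ)

/-- The effect of one instruction. -/
def Instr.exec (s : State) : Instr → State
  | .const r k => { s with reg := Function.update s.reg r k }
  | .move r a => { s with reg := Function.update s.reg r (s.reg a) }
  | .add r a b => { s with reg := Function.update s.reg r (s.reg a + s.reg b) }
  | .sub r a b => { s with reg := Function.update s.reg r (s.reg a - s.reg b) }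
  | .mul r a b => { s with reg := Function.update s.reg r (s.reg a * s.reg b) }
  | .load r a => { s with reg := Function.update s.reg r (s.mem (s.reg a)) }
  | .store a b => { s with mem := Function.update s.mem (s.reg a) (s.reg b) }
  | .emit a => { s with cur := s.cur ++ [s.reg a] }
  | .report => { s with cur := [], out := s.out ++ [s.cur] }

/-- The value of a test. -/
def Test.eval (s : State) : Test → Bool
  | .eq a b => decide (s.reg a = s.reg b)
  | .lt a b => decide (s.reg a < s.reg b)

/-- A configuration: the pieces of program text that remain to be executed, in order, and the
data. As there is no recursion, `code` takes only finitely many values during the runs of a given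
program: it is the finite control of the machine (a program counter), not a storage device. -/
structure Config where
  code : List Prog
  state : State

/-- One step of the machine. A halted machine stays as it is. -/
def Config.step : Config → Config
  | ⟨[], s⟩ => ⟨[], s⟩
  | ⟨.instr i :: k, s⟩ => ⟨k, i.exec s⟩
  | ⟨.seq p q :: k, s⟩ => ⟨p :: q :: k, s⟩
  | ⟨.cond b p q :: k, s⟩ => if b.eval s then ⟨p :: k, s⟩ else ⟨q :: k, s⟩
  | ⟨.loop b p :: k, s⟩ => if b.eval s then ⟨p :: .loop b p :: k, s⟩ else ⟨k, s⟩

/-- The machine has halted. -/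
def Config.Halted (c : Config) : Prop :=
  c.code = []

/-- The memory address, if any, that the next step reads or writes. -/
def Config.address : Config → Option ℕ
  | ⟨.instr (.load _ a) :: _, s⟩ => some (s.reg a)
  | ⟨.instr (.store a _) :: _, s⟩ => some (s.reg a)
  | _ => none

/-- The initial data for the input `(A, B)`: the memory holds
`|A|, |B|, A[1], …, A[|A|], B[1], …, B[|B|], 0, 0, …`, all registers are `0`, nothing has been
written. -/
def State.init (A B : List ℕ) : State where
  reg := fun _ => 0
  mem := fun i => (A.length :: B.length :: (A ++ B)).getD i 0
  cur := []
  out := []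

/-- The configuration of the program `P` on the input `(A, B)` after `t` steps. -/
def Prog.run (P : Prog) (A B : List ℕ) (t : ℕ) : Config :=
  Config.step^[t] ⟨[P], State.init A B⟩

/-- On the input `(A, B)`, the program `P` halts, and the strings that it has reported by then are
exactly the strings with the property `Sol`, each of them once. -/
def Prog.Enumerates (P : Prog) (A B : List ℕ) (Sol : List ℕ → Prop) : Prop :=
  ∃ T : ℕ, (P.run A B T).Halted ∧
    (P.run A B T).state.cur = [] ∧
    (P.run A B T).state.out.Nodup ∧
    ∀ S : List ℕ, S ∈ (P.run A B T).state.out ↔ Sol S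

/-- There is a preprocessing phase of at most `p` steps in which nothing is written, and from any
moment after it, within `d` further steps the next string of the output is reported or the machine
halts. So `d` bounds the time from the end of the preprocessing to the first report, between any
two consecutive reports, and from the last report to the end of the run. -/
def Prog.PreprocessingAndDelay (P : Prog) (A B : List ℕ) (p d : ℕ) : Prop :=
  ∃ t₀ ≤ p, (P.run A B t₀).state.cur = [] ∧ (P.run A B t₀).state.out = [] ∧
    ∀ t, t₀ ≤ t →
      (P.run A B t).state.out.length < (P.run A B (t + d)).state.out.length ∨
        (P.run A B (t + d)).Halted

/-- During the whole run, only the memory cells with addresses `0, …, m - 1` are accessed. -/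
def Prog.SpaceWithin (P : Prog) (A B : List ℕ) (m : ℕ) : Prop :=
  ∀ t, ∀ a ∈ (P.run A B t).address, a < m

/-- During the whole run, the content of every register and of every memory cell is a symbol of
the input or a number less than `w`. -/
def Prog.WordsWithin (P : Prog) (A B : List ℕ) (w : ℕ) : Prop :=
  ∀ t i,
    ((P.run A B t).state.reg i < w ∨ (P.run A B t).state.reg i ∈ A ++ B) ∧
    ((P.run A B t).state.mem i < w ∨ (P.run A B t).state.mem i ∈ A ++ B)

end WordRAM

/-!
A minimal common supersequence is built from left to right. If the rests of the two strings start
with the same symbol, then this symbol comes next, and minimality is inherited in both directions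
(`isMinimal_cons_cons_iff`). Otherwise the next symbol is the first one of one of the rests, and if
it belongs to the rest `c :: u` of `X`, say, then minimality is inherited under the condition that
`c :: u` does not fit into what follows (`isMinimal_cons_left_iff`). So the minimal common
supersequences correspond to paths of steps in both strings, in `A` alone and in `B` alone, subject
to conditions of the form "a certain suffix of `X` does not fit into the rest of the path".

These conditions are easy to maintain. A condition imposed by a step in `X` alone is superseded by
the next one (`Pending.of_not_sublist`), and until then the path spells out a part of `Y`, so that
the condition is violated as soon as the index of `Y` reaches, by a step in `Y` alone, a certain
`deadline`, which depends only on the two indices at which the condition was imposed. A node of the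
search tree is thus described by two indices and two limits on them, and `completions` lists the
paths that start at a node (`mem_completions_iff`).

To avoid dead ends, the search has to know whether a node has a completion. A node reached by a
step in `X` alone has a deadline as its limit for `Y`, so only the other limit is a free parameter,
and the answer depends on it monotonically: `exists_completion_iff` compares it with a `threshold`.
Deadlines and thresholds fill tables of quadratic size, each entry being computed in linear time
from later entries. After that, a depth-first search that always knows which steps lead on, and
that keeps the postponed steps on a stack, needs linear time from one leaf to the next: to descend,
to write the path, and to take up the last postponed step.

For the machine, `Exec` is a big-step semantics with a step count in which every instruction has to
respect bounds on addresses and numbers; `Exec.sound` relates it to the steps of the machine, and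
`Runs` with its rules is a logic for time-bounded total correctness. Programs without loops are
treated by weakest preconditions (`wp`). The bound on the delay is derived from a bound on one turn
of the main loop (`delay_of_loop`).
-/

namespace MinSuperseq

/-! ### Stripping the first symbol -/

variable {α : Type*}

theorem isMinimalCommonSupersequence_nil_iff (A B : List α) :
    IsMinimalCommonSupersequence A B [] ↔ A = [] ∧ B = [] := by
  constructor
  · rintro ⟨⟨h1, h2⟩, -⟩
    exact ⟨List.sublist_nil.1 h1, List.sublist_nil.1 h2⟩
  · rintro ⟨rfl, rfl⟩
    exact ⟨⟨List.Sublist.refl _, List.Sublist.refl _⟩,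
      fun T hT hne _ => hne (List.sublist_nil.1 hT)⟩

/-- A first symbol that neither string starts with could be dropped. -/
theorem head_of_isMinimal {A B : List α} {c : α} {S : List α}
    (h : IsMinimalCommonSupersequence A B (c :: S)) :
    (∃ u, A = c :: u) ∨ ∃ v, B = c :: v := by
  by_contra! hc
  obtain ⟨⟨h1, h2⟩, h3⟩ := h
  refine h3 S (List.sublist_cons_self c S) (by simp) ⟨?_, ?_⟩
  · cases h1 with
    | cons _ h => exact h
    | cons_cons _ h => exact absurd rfl (hc.1 _)
  · cases h2 with
    | cons _ h => exact h
    | cons_cons _ h => exact absurd rfl (hc.2 _)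

theorem sublist_of_cons_of_head_ne {v : List α} {c : α} {S : List α}
    (hv : ∀ w, v ≠ c :: w) : v.Sublist (c :: S) ↔ v.Sublist S := by
  constructor
  · intro h
    cases h with
    | cons _ h => exact h
    | cons_cons _ h => exact absurd rfl (hv _)
  · exact fun h => h.cons c

/-- A common first symbol is stripped without any further condition. For if both `c :: u` and
`c :: v` fitted into `S`, then `u` and `v` would fit into `S` without its first symbol, against the
minimality of `S` for `u` and `v`. -/
theorem isMinimal_cons_cons_iff (u v S : List α) (c : α) :
    IsMinimalCommonSupersequence (c :: u) (c :: v) (c :: S) ↔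
      IsMinimalCommonSupersequence u v S := by
  constructor
  · rintro ⟨⟨h1, h2⟩, h3⟩
    refine ⟨⟨List.cons_sublist_cons.1 h1, List.cons_sublist_cons.1 h2⟩, fun T hT hne hc => ?_⟩
    exact h3 (c :: T) (List.cons_sublist_cons.2 hT) (by simpa using hne)
      ⟨List.cons_sublist_cons.2 hc.1, List.cons_sublist_cons.2 hc.2⟩
  · rintro ⟨⟨h1, h2⟩, h3⟩
    refine ⟨⟨List.cons_sublist_cons.2 h1, List.cons_sublist_cons.2 h2⟩, fun T hT hne hc => ?_⟩
    cases hT with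
    | cons _ hT =>
      have hu := hc.1.trans hT
      have hv := hc.2.trans hT
      cases S with
      | nil => simp at hu
      | cons d S =>
        have key : ∀ w : List α, (c :: w).Sublist (d :: S) → w.Sublist S := by
          intro w hw
          cases hw with
          | cons _ h => exact (List.sublist_cons_self c w).trans h
          | cons_cons _ h => exact h
        exact h3 S (List.sublist_cons_self d S) (by simp) ⟨key u hu, key v hv⟩
    | cons_cons _ hT =>
      exact h3 _ hT (fun h => hne (by rw [h]))
        ⟨List.cons_sublist_cons.1 hc.1, List.cons_sublist_cons.1 hc.2⟩

/-- A first symbol that starts one of the strings only is stripped at the price of a condition: it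
must not be possible to do without it. -/
theorem isMinimal_cons_left_iff (u v S : List α) (c : α) (hv : ∀ w, v ≠ c :: w) :
    IsMinimalCommonSupersequence (c :: u) v (c :: S) ↔
      IsMinimalCommonSupersequence u v S ∧ ¬ (c :: u).Sublist S := by
  constructor
  · rintro ⟨⟨h1, h2⟩, h3⟩
    rw [sublist_of_cons_of_head_ne hv] at h2
    refine ⟨⟨⟨List.cons_sublist_cons.1 h1, h2⟩, fun T hT hne hc => ?_⟩, fun h => ?_⟩
    · exact h3 (c :: T) (List.cons_sublist_cons.2 hT) (by simpa using hne)
        ⟨List.cons_sublist_cons.2 hc.1, hc.2.cons c⟩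
    · exact h3 S (List.sublist_cons_self c S) (by simp) ⟨h, h2⟩
  · rintro ⟨⟨⟨h1, h2⟩, h3⟩, h4⟩
    refine ⟨⟨List.cons_sublist_cons.2 h1, h2.cons c⟩, fun T hT hne hc => ?_⟩
    cases hT with
    | cons _ hT => exact h4 (hc.1.trans hT)
    | cons_cons _ hT =>
      exact h3 _ hT (fun h => hne (by rw [h]))
        ⟨List.cons_sublist_cons.1 hc.1, (sublist_of_cons_of_head_ne hv).1 hc.2⟩

theorem isMinimal_comm (A B S : List α) :
    IsMinimalCommonSupersequence A B S ↔ IsMinimalCommonSupersequence B A S := by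
  simp only [IsMinimalCommonSupersequence, IsCommonSupersequence, and_comm]

theorem exists_isMinimal (A B : List α) : ∃ S, IsMinimalCommonSupersequence A B S := by
  have hne : ∃ n, ∃ S : List α, S.length = n ∧ IsCommonSupersequence A B S :=
    ⟨_, A ++ B, rfl, List.sublist_append_left A B, List.sublist_append_right A B⟩
  classical
  obtain ⟨S, hS, hc⟩ := Nat.find_spec hne
  refine ⟨S, hc, fun T hT hTS hcT => ?_⟩
  have h1 := Nat.find_min' hne ⟨T, rfl, hcT⟩
  exact hTS (hT.eq_of_length_le (by omega))

theorem drop_eq_getD_cons {X : List ℕ} {x : ℕ} (h : x < X.length) :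
    X.drop x = X.getD x 0 :: X.drop (x + 1) := by
  rw [List.drop_eq_getElem_cons h, List.getD_eq_getElem _ _ h]

/-! ### Deadlines and completions -/

/-- Both strings continue, and with the same symbol. -/
def Meet (X Y : List ℕ) (x y : ℕ) : Prop :=
  x < X.length ∧ y < Y.length ∧ X.getD x 0 = Y.getD y 0

instance (X Y : List ℕ) (x y : ℕ) : Decidable (Meet X Y x y) := by unfold Meet; infer_instance

theorem meet_comm {X Y : List ℕ} {x y : ℕ} : Meet X Y x y ↔ Meet Y X y x := by
  unfold Meet; constructor <;> (rintro ⟨h1, h2, h3⟩; exact ⟨h2, h1, h3.symm⟩)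

/-- While `Y` is read symbol by symbol from index `y` on, two indices move greedily through `X`,
one from `x` and one, behind it, from `a`. The deadline is the index of `Y` at which the second
one catches up with the first one, and `Y.length + 1` if this never happens. -/
def deadline (X Y : List ℕ) (x a y : ℕ) : ℕ :=
  if a < x then
    if y < Y.length then
      deadline X Y (if x < X.length ∧ X.getD x 0 = Y.getD y 0 then x + 1 else x)
        (if X.getD a 0 = Y.getD y 0 then a + 1 else a) (y + 1)
    else Y.length + 1
  else y
termination_by Y.length - y

theorem lt_deadline {X Y : List ℕ} {x a y : ℕ} (h : a < x) (hy : y ≤ Y.length) :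
    y < deadline X Y x a y := by
  induction hn : Y.length - y generalizing x a y with
  | zero => rw [deadline, if_pos h, if_neg (by omega)]; omega
  | succ n ih =>
    rw [deadline, if_pos h, if_pos (show y < Y.length by omega)]
    by_cases h' : (if X.getD a 0 = Y.getD y 0 then a + 1 else a) <
        (if x < X.length ∧ X.getD x 0 = Y.getD y 0 then x + 1 else x)
    · have := ih (y := y + 1) h' (by omega) (by omega); omega
    · rw [deadline, if_neg h']; omega

theorem deadline_le (X Y : List ℕ) (x a y : ℕ) (hy : y ≤ Y.length) :
    deadline X Y x a y ≤ Y.length + 1 := by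
  induction hn : Y.length - y generalizing x a y with
  | zero => rw [deadline]; split_ifs <;> omega
  | succ n ih =>
    rw [deadline]
    split_ifs <;> first | omega | exact ih _ _ _ (by omega) (by omega)

/-- The strings `S` that complete a partial supersequence in which the prefixes of lengths `x` and
`y` of `X` and `Y` are matched. A step in `X` alone has to lead to an index below the limit `I`, a
step in `Y` alone to an index below the limit `J`. A step in `X` alone replaces the limit `J` by a
deadline, and vice versa, whereas steps in both strings, which are forced where the strings meet,
are subject to no limit. -/
def completions (X Y : List ℕ) (x y I J : ℕ) : List (List ℕ) :=
  if x = X.length ∧ y = Y.length then [[]]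
  else if Meet X Y x y then
    (completions X Y (x + 1) (y + 1) I J).map (X.getD x 0 :: ·)
  else
    (if x < X.length ∧ x + 1 < I then
      (completions X Y (x + 1) y I (deadline X Y (x + 1) x y)).map (X.getD x 0 :: ·) else []) ++
    (if y < Y.length ∧ y + 1 < J then
      (completions X Y x (y + 1) (deadline Y X (y + 1) y x) J).map (Y.getD y 0 :: ·) else [])
termination_by (X.length - x) + (Y.length - y)
decreasing_by all_goals (try unfold Meet at *); omega

theorem completions_end (X Y : List ℕ) (I J : ℕ) :
    completions X Y X.length Y.length I J = [[]] := by
  rw [completions, if_pos ⟨rfl, rfl⟩]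

theorem completions_of_meet {X Y : List ℕ} {x y : ℕ} (h : Meet X Y x y) (I J : ℕ) :
    completions X Y x y I J = (completions X Y (x + 1) (y + 1) I J).map (X.getD x 0 :: ·) := by
  rw [completions, if_neg (by have := h.1; omega), if_pos h]

theorem completions_of_not_meet {X Y : List ℕ} {x y : ℕ} (h : ¬ Meet X Y x y)
    (he : ¬ (x = X.length ∧ y = Y.length)) (I J : ℕ) :
    completions X Y x y I J =
    (if x < X.length ∧ x + 1 < I then
      (completions X Y (x + 1) y I (deadline X Y (x + 1) x y)).map (X.getD x 0 :: ·) else []) ++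
    (if y < Y.length ∧ y + 1 < J then
      (completions X Y x (y + 1) (deadline Y X (y + 1) y x) J).map (Y.getD y 0 :: ·) else []) := by
  rw [completions, if_neg he, if_neg h]

theorem completions_nodup (X Y : List ℕ) (x y I J : ℕ) : (completions X Y x y I J).Nodup := by
  have hinj : ∀ c : ℕ, Function.Injective (fun S : List ℕ => c :: S) :=
    fun c S T h => (List.cons.inj h).2
  fun_induction completions X Y x y I J with
  | case1 => simp
  | case2 x y I J _ _ ih => exact ih.map (hinj _)
  | case3 x y I J he hm ih1 ih2 =>
    rw [List.nodup_append]
    refine ⟨?_, ?_, ?_⟩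
    · split_ifs with h
      · exact (ih1 h).map (hinj _)
      · exact List.nodup_nil
    · split_ifs with h
      · exact (ih2 h).map (hinj _)
      · exact List.nodup_nil
    · intro S hS T hT hST
      subst hST
      split_ifs at hS hT with h1 h2
      · obtain ⟨S1, -, h3⟩ := List.mem_map.1 hS
        obtain ⟨S2, -, h4⟩ := List.mem_map.1 hT
        exact hm ⟨h1.1, h2.1, (List.cons.inj (h3.trans h4.symm)).1⟩
      all_goals simp at hS hT

/-- The two orders of the strings give the same completions, but not in the same order. -/
theorem mem_completions_comm (X Y : List ℕ) (x y I J : ℕ) (S : List ℕ) :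
    S ∈ completions X Y x y I J ↔ S ∈ completions Y X y x J I := by
  fun_induction completions X Y x y I J generalizing S with
  | case1 x y I J h => rw [h.1, h.2, completions_end]
  | case2 x y I J _ h ih =>
    rw [completions_of_meet (meet_comm.1 h), ← h.2.2]
    simp only [List.mem_map, ih]
  | case3 x y I J he hm ih1 ih2 =>
    rw [completions_of_not_meet (fun h => hm (meet_comm.1 h)) (fun h => he h.symm)]
    simp only [List.mem_append]
    rw [or_comm]
    have e1 : ∀ h : x < X.length ∧ x + 1 < I, _ := fun h T => ih1 h T
    have e2 : ∀ h : y < Y.length ∧ y + 1 < J, _ := fun h T => ih2 h T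
    split_ifs with h1 h2 h2
    · simp only [List.mem_map, e1 h2, e2 h1]
    · simp only [List.mem_map, e2 h1]
    · simp only [List.mem_map, e1 h2]
    · rfl

theorem drop_sublist_cons_iff {X S : List ℕ} {a c : ℕ} (ha : a < X.length) :
    (X.drop a).Sublist (c :: S) ↔ (X.drop (if X.getD a 0 = c then a + 1 else a)).Sublist S := by
  rw [drop_eq_getD_cons ha]
  split_ifs with h
  · rw [h, List.cons_sublist_cons]
  · rw [sublist_of_cons_of_head_ne (fun w hw => h (List.cons.inj hw).1), drop_eq_getD_cons ha]

/-- `Pending X Y x y J c`: under the condition `c` on the rest `S` of the supersequence, the index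
of `Y` has to stay below `J` until the next step in `X` alone. The condition is that a suffix of
`X` that starts before `x` does not fit into `S`, or it is void. -/
def Pending (X Y : List ℕ) (x y J : ℕ) (c : List ℕ → Prop) : Prop :=
  (∃ a < x, J = deadline X Y x a y ∧ c = fun S => ¬ (X.drop a).Sublist S) ∨
    (J = Y.length + 1 ∧ c = fun _ => True)

theorem Pending.at_end {X Y : List ℕ} {x y J : ℕ} {c : List ℕ → Prop} (h : Pending X Y x y J c)
    (hx : x ≤ X.length) : c [] := by
  rcases h with ⟨a, ha, -, rfl⟩ | ⟨-, rfl⟩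
  · simp only [List.sublist_nil, List.drop_eq_nil_iff]; omega
  · trivial

theorem Pending.meet {X Y : List ℕ} {x y J : ℕ} {c : List ℕ → Prop} (h : Pending X Y x y J c)
    (hm : Meet X Y x y) :
    ∃ c', Pending X Y (x + 1) (y + 1) J c' ∧ ∀ S, c (X.getD x 0 :: S) ↔ c' S := by
  rcases h with ⟨a, ha, hJ, rfl⟩ | ⟨hJ, rfl⟩
  · have ha' : a < X.length := ha.trans hm.1
    rw [deadline, if_pos ha, if_pos hm.2.1, if_pos ⟨hm.1, hm.2.2⟩] at hJ
    refine ⟨_, Or.inl ⟨_, ?_, hJ, rfl⟩, fun S => ?_⟩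
    · split_ifs <;> omega
    · rw [hm.2.2]
      exact not_congr (drop_sublist_cons_iff ha')
  · exact ⟨_, Or.inr ⟨hJ, rfl⟩, fun S => Iff.rfl⟩

/-- A step in `X` alone replaces the pending condition by a stronger one. -/
theorem Pending.of_not_sublist {X Y : List ℕ} {x y J : ℕ} {c : List ℕ → Prop}
    (h : Pending X Y x y J c) (hx : x < X.length) {S : List ℕ} (hS : ¬ (X.drop x).Sublist S) :
    c (X.getD x 0 :: S) := by
  rcases h with ⟨a, ha, -, rfl⟩ | ⟨-, rfl⟩
  · intro hs
    apply hS
    replace hs := (drop_sublist_cons_iff (ha.trans hx)).1 hs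
    have hle : ∀ b, b ≤ x → (X.drop x).Sublist (X.drop b) := fun b hb => by
      rw [show x = b + (x - b) by omega, ← List.drop_drop]
      exact List.drop_sublist _ _
    refine (hle _ ?_).trans hs
    split_ifs <;> omega
  · trivial

theorem pending_step (X Y : List ℕ) (x y : ℕ) :
    Pending X Y (x + 1) y (deadline X Y (x + 1) x y) (fun S => ¬ (X.drop x).Sublist S) :=
  Or.inl ⟨x, by omega, rfl, rfl⟩

/-- A step in `Y` alone keeps the limit, and it is forbidden exactly if it reaches the limit. -/
theorem Pending.other {X Y : List ℕ} {x y J : ℕ} {c : List ℕ → Prop} (h : Pending X Y x y J c)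
    (hx : x ≤ X.length) (hy : y < Y.length) (hm : ¬ Meet X Y x y) :
    (y + 1 < J ∧ ∃ c', Pending X Y x (y + 1) J c' ∧ ∀ S, c (Y.getD y 0 :: S) ↔ c' S) ∨
    (¬ y + 1 < J ∧ ∀ S, (X.drop x).Sublist S → ¬ c (Y.getD y 0 :: S)) := by
  rcases h with ⟨a, ha, hJ, rfl⟩ | ⟨hJ, rfl⟩
  · have ha' : a < X.length := by omega
    rw [deadline, if_pos ha, if_pos hy, if_neg (fun h => hm ⟨h.1, hy, h.2⟩)] at hJ
    by_cases hlt : (if X.getD a 0 = Y.getD y 0 then a + 1 else a) < x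
    · refine Or.inl ⟨?_, _, Or.inl ⟨_, hlt, hJ, rfl⟩, fun S => ?_⟩
      · rw [hJ]; exact lt_deadline hlt hy
      · exact not_congr (drop_sublist_cons_iff ha')
    · right
      rw [deadline, if_neg hlt] at hJ
      refine ⟨by omega, fun S hS hc => hc ?_⟩
      split_ifs at hlt with h
      · rw [drop_eq_getD_cons ha', h, List.cons_sublist_cons]
        rwa [show a + 1 = x by omega]
      · exact absurd ha hlt
  · exact Or.inl ⟨by omega, _, Or.inr ⟨hJ, rfl⟩, fun S => Iff.rfl⟩

theorem mem_map_cons_iff {L : List (List ℕ)} {c d : ℕ} {S : List ℕ} :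
    d :: S ∈ L.map (c :: ·) ↔ d = c ∧ S ∈ L := by
  simp only [List.mem_map, List.cons.injEq]
  constructor
  · rintro ⟨T, hT, rfl, rfl⟩; exact ⟨rfl, hT⟩
  · rintro ⟨rfl, h⟩; exact ⟨S, h, rfl, rfl⟩

theorem head_ne_of_not_meet {X Y : List ℕ} {x y : ℕ} (hm : ¬ Meet X Y x y) (hx : x < X.length) :
    ∀ w, Y.drop y ≠ X.getD x 0 :: w := by
  intro w hw
  by_cases hy : y < Y.length
  · rw [drop_eq_getD_cons hy] at hw
    exact hm ⟨hx, hy, (List.cons.inj hw).1.symm⟩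
  · rw [List.drop_eq_nil_of_le (by omega)] at hw
    simp at hw

/-- The completions are the minimal common supersequences of what is left of the two strings,
under the two pending conditions. By `Pending.of_not_sublist` one condition per string is enough,
although each step in one string alone imposes a condition. -/
theorem mem_completions_iff {X Y : List ℕ} {x y I J : ℕ} {cX cY : List ℕ → Prop}
    (hx : x ≤ X.length) (hy : y ≤ Y.length)
    (hX : Pending X Y x y J cX) (hY : Pending Y X y x I cY) (S : List ℕ) :
    S ∈ completions X Y x y I J ↔
      IsMinimalCommonSupersequence (X.drop x) (Y.drop y) S ∧ cX S ∧ cY S := by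
  induction S generalizing x y I J cX cY with
  | nil =>
    rw [isMinimalCommonSupersequence_nil_iff, List.drop_eq_nil_iff, List.drop_eq_nil_iff]
    by_cases he : x = X.length ∧ y = Y.length
    · rw [he.1, he.2, completions_end]
      simp [hX.at_end hx, hY.at_end hy]
    · by_cases hm : Meet X Y x y
      · rw [completions_of_meet hm]
        have := hm.1
        simp; omega
      · rw [completions_of_not_meet hm he]
        constructor
        · intro h; split_ifs at h <;> simp at h
        · intro h; omega
  | cons d S ih =>
    by_cases he : x = X.length ∧ y = Y.length
    · rw [he.1, he.2, completions_end]
      simp only [List.drop_length, List.mem_singleton, reduceCtorEq, false_iff]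
      rintro ⟨h, -⟩
      rcases head_of_isMinimal h with ⟨u, hu⟩ | ⟨u, hu⟩ <;> simp at hu
    by_cases hm : Meet X Y x y
    · rw [completions_of_meet hm, mem_map_cons_iff]
      obtain ⟨cX', hX', eX⟩ := hX.meet hm
      obtain ⟨cY', hY', eY⟩ := hY.meet (meet_comm.1 hm)
      rw [← hm.2.2] at eY
      rw [ih hm.1 hm.2.1 hX' hY', drop_eq_getD_cons hm.1, drop_eq_getD_cons hm.2.1, ← hm.2.2]
      constructor
      · rintro ⟨rfl, h1, h2, h3⟩
        exact ⟨(isMinimal_cons_cons_iff _ _ _ _).2 h1, (eX S).2 h2, (eY S).2 h3⟩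
      · rintro ⟨h1, h2, h3⟩
        have hd : d = X.getD x 0 := by
          rcases head_of_isMinimal h1 with ⟨u, hu⟩ | ⟨u, hu⟩ <;> exact (List.cons.inj hu).1.symm
        subst hd
        exact ⟨rfl, (isMinimal_cons_cons_iff _ _ _ _).1 h1, (eX S).1 h2, (eY S).1 h3⟩
    · have hm' : ¬ Meet Y X y x := fun h => hm (meet_comm.1 h)
      -- the two kinds of steps, in a form that is symmetric in the two strings
      have key : ∀ (X Y : List ℕ) (x y I J : ℕ) (cX cY : List ℕ → Prop), x < X.length →
          y ≤ Y.length → ¬ Meet X Y x y → Pending X Y x y J cX → Pending Y X y x I cY →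
          (∀ cY', Pending Y X y (x + 1) I cY' →
            (S ∈ completions X Y (x + 1) y I (deadline X Y (x + 1) x y) ↔
              IsMinimalCommonSupersequence (X.drop (x + 1)) (Y.drop y) S ∧
                (¬ (X.drop x).Sublist S) ∧ cY' S)) →
          ((x + 1 < I ∧ S ∈ completions X Y (x + 1) y I (deadline X Y (x + 1) x y)) ↔
            IsMinimalCommonSupersequence (X.drop x) (Y.drop y) (X.getD x 0 :: S) ∧
              cX (X.getD x 0 :: S) ∧ cY (X.getD x 0 :: S)) := by
        intro X Y x y I J cX cY hx hy hm hX hY ih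
        have e := isMinimal_cons_left_iff (X.drop (x + 1)) (Y.drop y) S (X.getD x 0)
          (head_ne_of_not_meet hm hx)
        rw [← drop_eq_getD_cons hx] at e
        rw [e]
        rcases hY.other hy hx (fun h => hm (meet_comm.1 h)) with ⟨h1, cY', hY', eY⟩ | ⟨h1, h2⟩
        · rw [ih cY' hY', eY]
          constructor
          · rintro ⟨-, h3, h4, h5⟩
            exact ⟨⟨h3, h4⟩, hX.of_not_sublist hx h4, h5⟩
          · rintro ⟨⟨h3, h4⟩, -, h5⟩
            exact ⟨h1, h3, h4, h5⟩
        · constructor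
          · exact fun h => absurd h.1 h1
          · rintro ⟨⟨h3, -⟩, -, h5⟩
            exact absurd h5 (h2 S h3.1.2)
      have k1 : x < X.length → _ := fun hx' => key X Y x y I J cX cY hx' hy hm hX hY
        (fun cY' h => ih hx' hy (pending_step X Y x y) h)
      have k2 : y < Y.length → _ := fun hy' => key Y X y x J I cY cX hy' hx hm' hY hX
        (fun cX' h => by
          rw [mem_completions_comm, ih hx hy' h (pending_step Y X y x), isMinimal_comm]
          tauto)
      rw [completions_of_not_meet hm he, List.mem_append]
      have e1 : d :: S ∈ (if x < X.length ∧ x + 1 < I then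
          (completions X Y (x + 1) y I (deadline X Y (x + 1) x y)).map (X.getD x 0 :: ·) else [])
          ↔ x < X.length ∧ d = X.getD x 0 ∧
            (x + 1 < I ∧ S ∈ completions X Y (x + 1) y I (deadline X Y (x + 1) x y)) := by
        split_ifs with h
        · rw [mem_map_cons_iff]; tauto
        · simp only [List.not_mem_nil, false_iff]; tauto
      have e2 : d :: S ∈ (if y < Y.length ∧ y + 1 < J then
          (completions X Y x (y + 1) (deadline Y X (y + 1) y x) J).map (Y.getD y 0 :: ·) else [])
          ↔ y < Y.length ∧ d = Y.getD y 0 ∧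
            (y + 1 < J ∧ S ∈ completions Y X (y + 1) x J (deadline Y X (y + 1) y x)) := by
        split_ifs with h
        · rw [mem_map_cons_iff, mem_completions_comm]; tauto
        · simp only [List.not_mem_nil, false_iff]; tauto
      rw [e1, e2]
      constructor
      · rintro (⟨h1, rfl, h2⟩ | ⟨h1, rfl, h2⟩)
        · exact (k1 h1).1 h2
        · have := (k2 h1).1 h2
          rw [isMinimal_comm] at this
          tauto
      · rintro ⟨h1, h2, h3⟩
        rcases head_of_isMinimal h1 with ⟨u, hu⟩ | ⟨u, hu⟩
        · have hx' : x < X.length := by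
            by_contra hc
            rw [List.drop_eq_nil_of_le (by omega)] at hu
            simp at hu
          rw [drop_eq_getD_cons hx'] at hu
          obtain rfl := (List.cons.inj hu).1
          exact Or.inl ⟨hx', rfl, (k1 hx').2 ⟨h1, h2, h3⟩⟩
        · have hy' : y < Y.length := by
            by_contra hc
            rw [List.drop_eq_nil_of_le (by omega)] at hu
            simp at hu
          rw [drop_eq_getD_cons hy'] at hu
          obtain rfl := (List.cons.inj hu).1
          exact Or.inr ⟨hy', rfl, (k2 hy').2 ⟨(isMinimal_comm _ _ _).1 h1, h3, h2⟩⟩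

theorem mem_completions_start_iff (A B S : List ℕ) :
    S ∈ completions A B 0 0 (A.length + 1) (B.length + 1) ↔
      IsMinimalCommonSupersequence A B S := by
  rw [mem_completions_iff (Nat.zero_le _) (Nat.zero_le _) (Or.inr ⟨rfl, rfl⟩) (Or.inr ⟨rfl, rfl⟩)]
  simp

/-! ### Thresholds -/

/-- The point at which the two strings cease to continue with the same symbol. -/
def diagonalEnd (X Y : List ℕ) (x y : ℕ) : ℕ × ℕ :=
  if Meet X Y x y then diagonalEnd X Y (x + 1) (y + 1) else (x, y)
termination_by X.length - x
decreasing_by unfold Meet at *; omega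

theorem diagonalEnd_spec (X Y : List ℕ) (x y : ℕ) (hx : x ≤ X.length) (hy : y ≤ Y.length) :
    x ≤ (diagonalEnd X Y x y).1 ∧ y ≤ (diagonalEnd X Y x y).2 ∧
    (diagonalEnd X Y x y).1 ≤ X.length ∧ (diagonalEnd X Y x y).2 ≤ Y.length ∧
    (diagonalEnd X Y x y).1 + y = (diagonalEnd X Y x y).2 + x ∧
    ¬ Meet X Y (diagonalEnd X Y x y).1 (diagonalEnd X Y x y).2 := by
  fun_induction diagonalEnd X Y x y with
  | case1 x y h ih =>
    have := ih h.1 h.2.1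
    refine ⟨by omega, by omega, by omega, by omega, by omega, this.2.2.2.2.2⟩
  | case2 x y h => exact ⟨le_rfl, le_rfl, hx, hy, by omega, h⟩

theorem completions_diagonalEnd (X Y : List ℕ) (x y I J : ℕ) :
    (∃ S, S ∈ completions X Y x y I J) ↔
      ∃ S, S ∈ completions X Y (diagonalEnd X Y x y).1 (diagonalEnd X Y x y).2 I J := by
  fun_induction diagonalEnd X Y x y with
  | case1 x y h ih =>
    rw [← ih, completions_of_meet h]
    constructor
    · rintro ⟨S, hS⟩
      obtain ⟨T, hT, -⟩ := List.mem_map.1 hS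
      exact ⟨T, hT⟩
    · rintro ⟨T, hT⟩
      exact ⟨_, List.mem_map_of_mem hT⟩
  | case2 x y h => exact Iff.rfl

theorem threshold_decreasing {X Y : List ℕ} {x y : ℕ} (h : ¬ (X.length < x ∨ Y.length < y)) :
    Y.length + 1 - ((diagonalEnd X Y x y).2 + 1) + (X.length + 1 - (diagonalEnd X Y x y).1) <
        X.length + 1 - x + (Y.length + 1 - y) ∧
      X.length + 1 - ((diagonalEnd X Y x y).1 + 1) + (Y.length + 1 - (diagonalEnd X Y x y).2) <
        X.length + 1 - x + (Y.length + 1 - y) := by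
  have := diagonalEnd_spec X Y x y (by omega) (by omega)
  omega

/-- What the limit `I` has to exceed in order that there is a completion after a step in `X` alone
has led to the indices `x` and `y`. If, at the end of the diagonal, a step in `Y` alone can be
completed, then `I` does not matter any more, because this step replaces it; otherwise the next
step is in `X` alone and keeps `I`. For `x > X.length` no limit is sufficient. -/
def threshold (X Y : List ℕ) (x y : ℕ) : ℕ :=
  if h : X.length < x ∨ Y.length < y then X.length + 1
  else if (diagonalEnd X Y x y).1 + (diagonalEnd X Y x y).2 = X.length + Y.length then x
  else if threshold Y X ((diagonalEnd X Y x y).2 + 1) (diagonalEnd X Y x y).1 <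
      deadline X Y x (x - 1) y then x
  else threshold X Y ((diagonalEnd X Y x y).1 + 1) (diagonalEnd X Y x y).2
termination_by (X.length + 1 - x) + (Y.length + 1 - y)
decreasing_by
  · exact (threshold_decreasing h).1
  · exact (threshold_decreasing h).2

theorem threshold_of_gt {X Y : List ℕ} {x y : ℕ} (h : X.length < x) :
    threshold X Y x y = X.length + 1 := by
  rw [threshold, dif_pos (Or.inl h)]

theorem le_threshold (X Y : List ℕ) (x y : ℕ) (hx : x ≤ X.length + 1) :
    x ≤ threshold X Y x y := by
  fun_induction threshold X Y x y with
  | case1 => omega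
  | case2 => exact le_rfl
  | case3 => exact le_rfl
  | case4 X Y x y h h1 h2 ih1 ih2 =>
    have := diagonalEnd_spec X Y x y (by omega) (by omega)
    have := ih2 (by omega)
    omega

/-- Whether there is a completion after a step in `X` alone depends on `I` only through a comparison
with a number that is independent of `I`. -/
theorem exists_completion_iff (X Y : List ℕ) (x y I : ℕ) (hx : x ≤ X.length) (hy : y ≤ Y.length)
    (hxI : x < I) (hI : I ≤ X.length + 1) :
    (∃ S, S ∈ completions X Y x y I (deadline X Y x (x - 1) y)) ↔ threshold X Y x y < I := by
  induction hn : (X.length - x) + (Y.length - y) using Nat.strong_induction_on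
    generalizing X Y x y I with
  | _ n ih =>
  subst hn
  obtain ⟨h1, h2, h3, h4, h5, hm⟩ := diagonalEnd_spec X Y x y hx hy
  rw [completions_diagonalEnd, threshold, dif_neg (by omega)]
  generalize (diagonalEnd X Y x y).1 = x' at *
  generalize (diagonalEnd X Y x y).2 = y' at *
  have hJ := deadline_le X Y x (x - 1) y hy
  generalize deadline X Y x (x - 1) y = J at *
  by_cases he : x' = X.length ∧ y' = Y.length
  · rw [if_pos (by omega), he.1, he.2, completions_end]
    simpa using hxI
  rw [if_neg (by omega), completions_of_not_meet hm he]
  -- after another step in `X` alone, and after a step in `Y` alone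
  have e1 : (∃ S, S ∈ (if x' < X.length ∧ x' + 1 < I then
      (completions X Y (x' + 1) y' I (deadline X Y (x' + 1) x' y')).map (X.getD x' 0 :: ·)
      else [])) ↔ threshold X Y (x' + 1) y' < I := by
    have hle := le_threshold X Y (x' + 1) y' (by omega)
    split_ifs with h
    · rw [← ih _ (by omega) X Y (x' + 1) y' I (by omega) h4 h.2 hI rfl, Nat.add_sub_cancel]
      simp
    · simp only [List.not_mem_nil, exists_false, false_iff]
      by_cases hx' : x' < X.length
      · omega
      · rw [threshold_of_gt (by omega)]; omega
  have e2 : (∃ S, S ∈ (if y' < Y.length ∧ y' + 1 < J then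
      (completions X Y x' (y' + 1) (deadline Y X (y' + 1) y' x') J).map (Y.getD y' 0 :: ·)
      else [])) ↔ threshold Y X (y' + 1) x' < J := by
    have hle := le_threshold Y X (y' + 1) x' (by omega)
    split_ifs with h
    · rw [← ih _ (by omega) Y X (y' + 1) x' J (by omega) h3 h.2 hJ rfl, Nat.add_sub_cancel]
      simp [mem_completions_comm Y X]
    · simp only [List.not_mem_nil, exists_false, false_iff]
      by_cases hy' : y' < Y.length
      · omega
      · rw [threshold_of_gt (by omega)]; omega
  simp only [List.mem_append, exists_or]
  rw [e1, e2]
  split_ifs with h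
  · simp [h, hxI]
  · simp [h]

end MinSuperseq

namespace WordRAM

/-! ### A program logic for the machine -/

/-- Bounds that a run has to respect: the number of memory cells, a bound on the numbers, and the
symbols that are exempt from it. -/
structure Limits where
  space : ℕ
  word : ℕ
  input : List ℕ

variable {L : Limits}

/-- All registers and memory cells hold numbers below the bound or symbols of the input. -/
def State.Fits (L : Limits) (s : State) : Prop :=
  ∀ i, (s.reg i < L.word ∨ s.reg i ∈ L.input) ∧ (s.mem i < L.word ∨ s.mem i ∈ L.input)

/-- The instruction accesses no cell beyond the limit and computes no number beyond the limit.
Instructions that only copy a value need no condition. -/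
def Instr.Ok (L : Limits) (s : State) : Instr → Prop
  | .const _ k => k < L.word
  | .add _ a b => s.reg a + s.reg b < L.word
  | .sub _ a b => s.reg a - s.reg b < L.word
  | .mul _ a b => s.reg a * s.reg b < L.word
  | .load _ a => s.reg a < L.space
  | .store a _ => s.reg a < L.space
  | _ => True

/-- The next step stays within the memory, and all numbers are admissible. -/
def Config.Safe (L : Limits) (c : Config) : Prop :=
  (∀ a ∈ c.address, a < L.space) ∧ c.state.Fits L

/-- Big-step semantics with a step count: started in `s`, the program `p` ends in `s'` after `n`
steps and respects the limits. -/
inductive Exec (L : Limits) : Prog → State → ℕ → State → Prop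
  | instr {i : Instr} {s : State} : i.Ok L s → Exec L (.instr i) s 1 (i.exec s)
  | seq {p q : Prog} {s s' s'' : State} {n n' : ℕ} :
      Exec L p s n s' → Exec L q s' n' s'' → Exec L (.seq p q) s (n + n' + 1) s''
  | cond_true {b : Test} {p q : Prog} {s s' : State} {n : ℕ} :
      b.eval s = true → Exec L p s n s' → Exec L (.cond b p q) s (n + 1) s'
  | cond_false {b : Test} {p q : Prog} {s s' : State} {n : ℕ} :
      b.eval s = false → Exec L q s n s' → Exec L (.cond b p q) s (n + 1) s'
  | loop_false {b : Test} {p : Prog} {s : State} :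
      b.eval s = false → Exec L (.loop b p) s 1 s
  | loop_true {b : Test} {p : Prog} {s s' s'' : State} {n n' : ℕ} :
      b.eval s = true → Exec L p s n s' → Exec L (.loop b p) s' n' s'' →
      Exec L (.loop b p) s (n + n' + 1) s''

/-- `n` steps lead from `c` to `c'`, and all configurations before `c'` are safe. -/
def SafeRun (L : Limits) (c : Config) (n : ℕ) (c' : Config) : Prop :=
  Config.step^[n] c = c' ∧ ∀ t < n, (Config.step^[t] c).Safe L

theorem SafeRun.trans {c c' c'' : Config} {n n' : ℕ} (h : SafeRun L c n c')
    (h' : SafeRun L c' n' c'') : SafeRun L c (n + n') c'' := by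
  have e : ∀ t, Config.step^[t + n] c = Config.step^[t] c' := fun t => by
    rw [Function.iterate_add_apply, h.1]
  refine ⟨by rw [add_comm, e, h'.1], fun t ht => ?_⟩
  by_cases h1 : t < n
  · exact h.2 t h1
  · rw [show t = (t - n) + n by omega, e]
    exact h'.2 _ (by omega)

theorem SafeRun.one {c : Config} (h : c.Safe L) : SafeRun L c 1 c.step :=
  ⟨rfl, fun t ht => by rw [Nat.lt_one_iff.1 ht]; exact h⟩

theorem SafeRun.cons {c c' : Config} {n : ℕ} (h : c.Safe L) (h' : SafeRun L c.step n c') :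
    SafeRun L c (n + 1) c' := by
  rw [add_comm]; exact (SafeRun.one h).trans h'

theorem State.Fits.exec {s : State} (h : s.Fits L) {i : Instr} (hi : i.Ok L s) :
    (i.exec s).Fits L := by
  intro q
  cases i <;> simp only [Instr.exec, Instr.Ok, Function.update_apply] at * <;> refine ⟨?_, ?_⟩ <;>
    try split_ifs
  all_goals first
    | exact (h _).1
    | exact (h _).2
    | exact Or.inl hi

/-- An execution respects the limits all along, whatever remains to be executed after it. -/
theorem Exec.sound {p : Prog} {s s' : State} {n : ℕ} (h : Exec L p s n s') (hs : s.Fits L) :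
    s'.Fits L ∧ ∀ k, SafeRun L ⟨p :: k, s⟩ n ⟨k, s'⟩ := by
  induction h with
  | @instr i s hi =>
    refine ⟨hs.exec hi, fun k => SafeRun.one ⟨?_, hs⟩⟩
    intro a ha
    cases i <;> simp [Config.address, Instr.Ok] at * <;> omega
  | seq _ _ ih1 ih2 =>
    obtain ⟨h1, r1⟩ := ih1 hs
    obtain ⟨h2, r2⟩ := ih2 h1
    exact ⟨h2, fun k => .cons ⟨by simp [Config.address], hs⟩ ((r1 _).trans (r2 k))⟩
  | cond_true hb _ ih =>
    obtain ⟨h1, r1⟩ := ih hs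
    refine ⟨h1, fun k => .cons ⟨by simp [Config.address], hs⟩ ?_⟩
    simpa [Config.step, hb] using r1 k
  | cond_false hb _ ih =>
    obtain ⟨h1, r1⟩ := ih hs
    refine ⟨h1, fun k => .cons ⟨by simp [Config.address], hs⟩ ?_⟩
    simpa [Config.step, hb] using r1 k
  | @loop_false b p s hb =>
    refine ⟨hs, fun k => ?_⟩
    have := SafeRun.one (L := L) (c := ⟨.loop b p :: k, s⟩) ⟨by simp [Config.address], hs⟩
    simpa [Config.step, hb] using this
  | loop_true hb _ _ ih1 ih2 =>
    obtain ⟨h1, r1⟩ := ih1 hs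
    obtain ⟨h2, r2⟩ := ih2 h1
    refine ⟨h2, fun k => .cons ⟨by simp [Config.address], hs⟩ ?_⟩
    have := (r1 _).trans (r2 k)
    simpa [Config.step, hb] using this

/-- The program writes to registers with numbers `b`, `b + 1`, … only. -/
def Prog.WritesFrom (b : ℕ) : Prog → Bool
  | .instr (.const r _) | .instr (.move r _) | .instr (.add r _ _) | .instr (.sub r _ _)
  | .instr (.mul r _ _) | .instr (.load r _) => decide (b ≤ r)
  | .instr _ => true
  | .seq p q => p.WritesFrom b && q.WritesFrom b
  | .cond _ p q => p.WritesFrom b && q.WritesFrom b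
  | .loop _ p => p.WritesFrom b

theorem Exec.reg_eq {p : Prog} {s s' : State} {n : ℕ} (h : Exec L p s n s') {b : ℕ}
    (hp : p.WritesFrom b = true) {r : ℕ} (hr : r < b) : s'.reg r = s.reg r := by
  induction h with
  | @instr i s hi =>
    cases i <;> simp [Prog.WritesFrom, Instr.exec, Function.update_apply] at * <;> omega
  | seq _ _ ih1 ih2 =>
    simp only [Prog.WritesFrom, Bool.and_eq_true] at hp
    rw [ih2 hp.2, ih1 hp.1]
  | cond_true _ _ ih =>
    simp only [Prog.WritesFrom, Bool.and_eq_true] at hp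
    exact ih hp.1
  | cond_false _ _ ih =>
    simp only [Prog.WritesFrom, Bool.and_eq_true] at hp
    exact ih hp.2
  | loop_false => rfl
  | loop_true _ _ _ ih1 ih2 => rw [ih2 hp, ih1 hp]

/-- The program contains no output instruction. -/
def Prog.Silent : Prog → Bool
  | .instr (.emit _) | .instr .report => false
  | .instr _ => true
  | .seq p q => p.Silent && q.Silent
  | .cond _ p q => p.Silent && q.Silent
  | .loop _ p => p.Silent

theorem Exec.output_eq {p : Prog} {s s' : State} {n : ℕ} (h : Exec L p s n s')
    (hp : p.Silent = true) : s'.cur = s.cur ∧ s'.out = s.out := by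
  induction h with
  | @instr i s hi => cases i <;> simp [Prog.Silent, Instr.exec] at *
  | seq _ _ ih1 ih2 =>
    simp only [Prog.Silent, Bool.and_eq_true] at hp
    rw [(ih2 hp.2).1, (ih2 hp.2).2]
    exact ih1 hp.1
  | cond_true _ _ ih =>
    simp only [Prog.Silent, Bool.and_eq_true] at hp
    exact ih hp.1
  | cond_false _ _ ih =>
    simp only [Prog.Silent, Bool.and_eq_true] at hp
    exact ih hp.2
  | loop_false => exact ⟨rfl, rfl⟩
  | loop_true _ _ _ ih1 ih2 =>
    rw [(ih2 hp).1, (ih2 hp).2]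
    exact ih1 hp

/-- Total correctness within `N` steps and within the limits. -/
def Runs (L : Limits) (p : Prog) (s : State) (N : ℕ) (Q : State → Prop) : Prop :=
  ∃ n ≤ N, ∃ s', Exec L p s n s' ∧ Q s'

theorem Runs.mono {p : Prog} {s : State} {N N' : ℕ} {Q Q' : State → Prop}
    (h : Runs L p s N Q) (hN : N ≤ N') (hQ : ∀ s', Q s' → Q' s') : Runs L p s N' Q' := by
  obtain ⟨n, hn, s', he, hq⟩ := h
  exact ⟨n, hn.trans hN, s', he, hQ _ hq⟩

/-- The postcondition may use that low registers are untouched. -/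
theorem Runs.frame {p : Prog} {s : State} {N : ℕ} {Q : State → Prop} (h : Runs L p s N Q) {b : ℕ}
    (hp : p.WritesFrom b = true) :
    Runs L p s N (fun s' => Q s' ∧ ∀ r < b, s'.reg r = s.reg r) := by
  obtain ⟨n, hn, s', he, hq⟩ := h
  exact ⟨n, hn, s', he, hq, fun r hr => he.reg_eq hp hr⟩

theorem Runs.silent {p : Prog} {s : State} {N : ℕ} {Q : State → Prop} (h : Runs L p s N Q)
    (hp : p.Silent = true) :
    Runs L p s N (fun s' => Q s' ∧ s'.cur = s.cur ∧ s'.out = s.out) := by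
  obtain ⟨n, hn, s', he, hq⟩ := h
  exact ⟨n, hn, s', he, hq, he.output_eq hp⟩

theorem Runs.seq {p q : Prog} {s : State} {N N' M : ℕ} {Q R : State → Prop}
    (h : Runs L p s N Q) (h' : ∀ s', Q s' → Runs L q s' N' R) (hM : N + N' + 1 ≤ M) :
    Runs L (.seq p q) s M R := by
  obtain ⟨n, hn, s', he, hq⟩ := h
  obtain ⟨n', hn', s'', he', hq'⟩ := h' s' hq
  exact ⟨_, by omega, s'', .seq he he', hq'⟩

theorem Runs.cond {b : Test} {p q : Prog} {s : State} {N M : ℕ} {R : State → Prop}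
    (h : b.eval s = true → Runs L p s N R) (h' : b.eval s = false → Runs L q s N R)
    (hM : N + 1 ≤ M) : Runs L (.cond b p q) s M R := by
  cases hb : b.eval s
  · obtain ⟨n, hn, s', he, hq⟩ := h' hb
    exact ⟨_, by omega, s', .cond_false hb he, hq⟩
  · obtain ⟨n, hn, s', he, hq⟩ := h hb
    exact ⟨_, by omega, s', .cond_true hb he, hq⟩

/-- The rule for loops; the argument of the invariant decreases from turn to turn. -/
theorem Runs.loop {b : Test} {p : Prog} {c : ℕ} (Inv : ℕ → State → Prop)
    (hstep : ∀ k s, Inv k s → b.eval s = true → Runs L p s c (fun s' => ∃ k' < k, Inv k' s'))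
    {k : ℕ} {s : State} (h : Inv k s) :
    Runs L (.loop b p) s (k * (c + 1) + 1) (fun s' => (∃ k', Inv k' s') ∧ b.eval s' = false) := by
  induction k using Nat.strong_induction_on generalizing s with
  | _ k ih =>
    cases hb : b.eval s
    · exact ⟨1, by omega, s, .loop_false hb, ⟨k, h⟩, hb⟩
    · obtain ⟨n, hn, s', he, k', hk', h'⟩ := hstep k s h hb
      obtain ⟨n', hn', s'', he', hq⟩ := ih k' hk' h'
      refine ⟨_, ?_, s'', .loop_true hb he he', hq⟩
      have : (k' + 1) * (c + 1) ≤ k * (c + 1) := Nat.mul_le_mul_right _ hk'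
      rw [Nat.add_mul] at this
      omega

/-- Weakest preconditions of programs without loops, within the limits. -/
def wp (L : Limits) : Prog → (State → Prop) → State → Prop
  | .instr i, Q, s => i.Ok L s ∧ Q (i.exec s)
  | .seq p q, Q, s => wp L p (wp L q Q) s
  | .cond b p q, Q, s => (b.eval s = true → wp L p Q s) ∧ (b.eval s = false → wp L q Q s)
  | .loop _ _, _, _ => False

/-- A bound on the number of steps of a program without loops. For loops it is a dummy value. -/
def Prog.cost : Prog → ℕ
  | .instr _ => 1
  | .seq p q => p.cost + q.cost + 1
  | .cond _ p q => max p.cost q.cost + 1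
  | .loop _ _ => 0

theorem Runs.of_wp {p : Prog} {s : State} {Q : State → Prop} (h : wp L p Q s) :
    Runs L p s p.cost Q := by
  induction p generalizing s Q with
  | instr i => exact ⟨1, le_rfl, _, .instr h.1, h.2⟩
  | seq p q ihp ihq => exact (ihp h).seq (fun s' hs' => ihq hs') le_rfl
  | cond b p q ihp ihq =>
    exact Runs.cond (N := max p.cost q.cost)
      (fun hb => (ihp (h.1 hb)).mono (le_max_left _ _) (fun _ h => h))
      (fun hb => (ihq (h.2 hb)).mono (le_max_right _ _) (fun _ h => h)) le_rfl
  | loop => exact h.elim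

theorem Runs.of_wp_le {p : Prog} {s : State} {Q : State → Prop} {N : ℕ} (h : wp L p Q s)
    (hN : p.cost ≤ N) : Runs L p s N Q :=
  (Runs.of_wp h).mono hN (fun _ h => h)

theorem wp_mono {p : Prog} {s : State} {Q Q' : State → Prop} (h : wp L p Q s)
    (hQ : ∀ s, Q s → Q' s) : wp L p Q' s := by
  induction p generalizing s Q Q' with
  | instr i => exact ⟨h.1, hQ _ h.2⟩
  | seq p q ihp ihq => exact ihp h (fun s' hs' => ihq hs' hQ)
  | cond b p q ihp ihq => exact ⟨fun hb => ihp (h.1 hb) hQ, fun hb => ihq (h.2 hb) hQ⟩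
  | loop => exact h.elim

/-- The state after a number has been written to a register. -/
def State.setReg (s : State) (r v : ℕ) : State := { s with reg := Function.update s.reg r v }

/-- The state after a number has been written to a memory cell. -/
def State.setMem (s : State) (a v : ℕ) : State := { s with mem := Function.update s.mem a v }

section simp_lemmas

variable (s : State) (r a b k v q : ℕ)

@[simp] theorem State.reg_setReg : (s.setReg r v).reg q = if q = r then v else s.reg q := by
  simp [State.setReg, Function.update_apply]

@[simp] theorem State.mem_setReg : (s.setReg r v).mem = s.mem := rfl
@[simp] theorem State.cur_setReg : (s.setReg r v).cur = s.cur := rfl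
@[simp] theorem State.out_setReg : (s.setReg r v).out = s.out := rfl
@[simp] theorem State.reg_setMem : (s.setMem a v).reg = s.reg := rfl

@[simp] theorem State.mem_setMem : (s.setMem a v).mem q = if q = a then v else s.mem q := by
  simp [State.setMem, Function.update_apply]

@[simp] theorem State.setReg_setReg_same : (s.setReg r v).setReg r b = s.setReg r b := by
  simp [State.setReg]

variable (Q : State → Prop) (p p' : Prog)

@[simp] theorem wp_const :
    wp L (.instr (.const r k)) Q s ↔ k < L.word ∧ Q (s.setReg r k) := Iff.rfl
@[simp] theorem wp_move :
    wp L (.instr (.move r a)) Q s ↔ Q (s.setReg r (s.reg a)) := ⟨fun h => h.2, fun h => ⟨trivial, h⟩⟩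
@[simp] theorem wp_add : wp L (.instr (.add r a b)) Q s ↔
    s.reg a + s.reg b < L.word ∧ Q (s.setReg r (s.reg a + s.reg b)) := Iff.rfl
@[simp] theorem wp_sub : wp L (.instr (.sub r a b)) Q s ↔
    s.reg a - s.reg b < L.word ∧ Q (s.setReg r (s.reg a - s.reg b)) := Iff.rfl
@[simp] theorem wp_mul : wp L (.instr (.mul r a b)) Q s ↔
    s.reg a * s.reg b < L.word ∧ Q (s.setReg r (s.reg a * s.reg b)) := Iff.rfl
@[simp] theorem wp_load : wp L (.instr (.load r a)) Q s ↔
    s.reg a < L.space ∧ Q (s.setReg r (s.mem (s.reg a))) := Iff.rfl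
@[simp] theorem wp_store : wp L (.instr (.store a b)) Q s ↔
    s.reg a < L.space ∧ Q (s.setMem (s.reg a) (s.reg b)) := Iff.rfl
@[simp] theorem wp_seq : wp L (.seq p p') Q s ↔ wp L p (wp L p' Q) s := Iff.rfl
@[simp] theorem wp_cond_eq : wp L (.cond (.eq a b) p p') Q s ↔
    (s.reg a = s.reg b → wp L p Q s) ∧ (s.reg a ≠ s.reg b → wp L p' Q s) := by
  simp [wp, Test.eval]
@[simp] theorem wp_cond_lt : wp L (.cond (.lt a b) p p') Q s ↔
    (s.reg a < s.reg b → wp L p Q s) ∧ (¬ s.reg a < s.reg b → wp L p' Q s) := by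
  simp [wp, Test.eval]

end simp_lemmas

/-! ### Halting and delay -/

theorem step_halted {c : Config} (h : c.Halted) (t : ℕ) : Config.step^[t] c = c := by
  induction t with
  | zero => rfl
  | succ t ih =>
    rw [Function.iterate_succ_apply', ih]
    obtain ⟨k, s⟩ := c
    obtain rfl : k = [] := h
    rfl

theorem out_length_step (c : Config) : c.state.out.length ≤ c.step.state.out.length := by
  obtain ⟨_ | ⟨p, k⟩, s⟩ := c
  · exact le_rfl
  · cases p with
    | instr i => cases i <;> simp [Config.step, Instr.exec]
    | seq => exact le_rfl
    | cond b p q => simp only [Config.step]; split_ifs <;> exact le_rfl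
    | loop b p => simp only [Config.step]; split_ifs <;> exact le_rfl

theorem out_length_mono (c : Config) {t t' : ℕ} (h : t ≤ t') :
    (Config.step^[t] c).state.out.length ≤ (Config.step^[t'] c).state.out.length := by
  obtain ⟨d, rfl⟩ := Nat.exists_eq_add_of_le h
  induction d with
  | zero => exact le_rfl
  | succ d ih =>
    refine (ih (by omega)).trans ?_
    rw [← add_assoc, Function.iterate_succ_apply']
    exact out_length_step _

/-- The delay of a loop each turn of which takes at most `c` steps and reports exactly one string,
where `Inv r` says that `r` turns are to come. At a given moment the report of the current turn may
be past already, and then the next report is that of the following turn: hence the factor `2`. -/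
theorem delay_of_loop {b : Test} {p : Prog} {c : ℕ} (Inv : ℕ → State → Prop)
    (h0 : ∀ s, Inv 0 s → b.eval s = false)
    (hstep : ∀ r s, Inv (r + 1) s → b.eval s = true ∧
      Runs L p s c (fun s' => Inv r s' ∧ s'.out.length = s.out.length + 1))
    {r : ℕ} {s : State} (h : Inv r s) (hs : s.Fits L) (t : ℕ) :
    (Config.step^[t] ⟨[.loop b p], s⟩).state.out.length <
        (Config.step^[t + 2 * (c + 1)] ⟨[.loop b p], s⟩).state.out.length ∨
      (Config.step^[t + 2 * (c + 1)] ⟨[.loop b p], s⟩).Halted := by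
  have halt : ∀ s, Inv 0 s → ∀ t, 1 ≤ t → (Config.step^[t] ⟨[.loop b p], s⟩).Halted := by
    intro s h t ht
    obtain ⟨t, rfl⟩ := Nat.exists_eq_add_of_le' ht
    have h1 : Config.step ⟨[.loop b p], s⟩ = ⟨[], s⟩ := by simp [Config.step, h0 s h]
    rw [Function.iterate_succ_apply, h1, step_halted (by exact rfl)]
    exact rfl
  have turn : ∀ r s, Inv (r + 1) s → s.Fits L → ∃ n ≤ c + 1, ∃ s', Inv r s' ∧ s'.Fits L ∧
      s'.out.length = s.out.length + 1 ∧
      ∀ t, Config.step^[t + n] ⟨[.loop b p], s⟩ = Config.step^[t] ⟨[.loop b p], s'⟩ := by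
    intro r s h hs
    obtain ⟨hb, n, hn, s', he, hi, ho⟩ := hstep r s h
    obtain ⟨hf, hr⟩ := he.sound hs
    refine ⟨n + 1, by omega, s', hi, hf, ho, fun t => ?_⟩
    rw [Function.iterate_add_apply, Function.iterate_succ_apply]
    have h1 : Config.step ⟨[.loop b p], s⟩ = ⟨[p, .loop b p], s⟩ := by simp [Config.step, hb]
    rw [h1, (hr [.loop b p]).1]
  induction r generalizing s t with
  | zero => exact Or.inr (halt s h _ (by omega))
  | succ r ih =>
    obtain ⟨n, hn, s', hi, hf, ho, e⟩ := turn r s h hs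
    by_cases ht : n ≤ t
    · obtain ⟨t, rfl⟩ := Nat.exists_eq_add_of_le' ht
      rw [show t + n + 2 * (c + 1) = (t + 2 * (c + 1)) + n by omega, e, e]
      exact ih hi hf t
    · have hle := out_length_mono ⟨[.loop b p], s⟩ (show t ≤ 0 + n by omega)
      rw [e] at hle
      cases r with
      | zero =>
        right
        rw [show t + 2 * (c + 1) = (t + 2 * (c + 1) - n) + n by omega, e]
        exact halt s' hi _ (by omega)
      | succ r =>
        left
        obtain ⟨n', hn', s'', -, -, ho', e'⟩ := turn r s' hi hf
        have hle' := out_length_mono ⟨[.loop b p], s⟩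
          (show (0 + n') + n ≤ t + 2 * (c + 1) by omega)
        rw [e, e'] at hle'
        simp only [Function.iterate_zero, id_eq] at hle hle'
        omega

theorem exec_of_loop {b : Test} {p : Prog} {c : ℕ} (Inv : ℕ → State → Prop)
    (h0 : ∀ s, Inv 0 s → b.eval s = false)
    (hstep : ∀ r s, Inv (r + 1) s → b.eval s = true ∧
      Runs L p s c (fun s' => Inv r s'))
    {r : ℕ} {s : State} (h : Inv r s) : ∃ n s', Exec L (.loop b p) s n s' ∧ Inv 0 s' := by
  induction r generalizing s with
  | zero => exact ⟨_, s, .loop_false (h0 s h), h⟩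
  | succ r ih =>
    obtain ⟨hb, n, -, s', he, hi⟩ := hstep r s h
    obtain ⟨n', s'', he', hi'⟩ := ih hi
    exact ⟨_, s'', .loop_true hb he he', hi'⟩

end WordRAM

open MinSuperseq

namespace WordRAM

/-! ### Memory layout -/

infixr:60 " ⨾ " => Prog.seq

/-- The memory is used as a three-dimensional array: the address of the cell with row `i`, kind
`k < 16` and column `j < n + 2`. The input fills row `0` of kind `0`. The kinds `1` and `2` are the
tables of thresholds, `3` and `4` the tables of deadlines; row `0` of the kinds `5` to `9` is the
stack of the search, and row `0` of kind `10` is the string under construction. -/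
def cell (n i k j : ℕ) : ℕ := (i * 16 + k) * (n + 2) + j

theorem cell_inj {n i k j i' k' j' : ℕ} (hk : k < 16) (hj : j < n + 2) (hk' : k' < 16)
    (hj' : j' < n + 2) : cell n i k j = cell n i' k' j' ↔ i = i' ∧ k = k' ∧ j = j' := by
  constructor
  · intro h
    have h1 : i * 16 + k = i' * 16 + k' := by
      have := congrArg (· / (n + 2)) h
      simp only [cell, mul_comm _ (n + 2)] at this
      rwa [Nat.mul_add_div (by omega), Nat.mul_add_div (by omega), Nat.div_eq_of_lt hj,
        Nat.div_eq_of_lt hj'] at this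
    unfold cell at h
    rw [h1] at h
    omega
  · rintro ⟨rfl, rfl, rfl⟩; rfl

/-- The limits within which the machine is going to work. The exponent of `word` is such that
addresses, of the size of `16 * (n + 2) ^ 2`, fit easily. -/
def limits (A B : List ℕ) : Limits where
  space := 16 * (A.length + B.length + 2) ^ 2
  word := (A.length + B.length + 2) ^ 7
  input := A ++ B

theorem space_le_word (A B : List ℕ) : 2 * (limits A B).space ≤ (limits A B).word := by
  have h : 2 ^ 5 ≤ (A.length + B.length + 2) ^ 5 := Nat.pow_le_pow_left (by omega) 5
  calc 2 * (16 * (A.length + B.length + 2) ^ 2)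
      = 2 ^ 5 * (A.length + B.length + 2) ^ 2 := by ring
    _ ≤ (A.length + B.length + 2) ^ 5 * (A.length + B.length + 2) ^ 2 :=
      Nat.mul_le_mul_right _ h
    _ = _ := by simp only [limits]; ring

theorem le_space (A B : List ℕ) : 32 * (A.length + B.length + 2) ≤ (limits A B).space := by
  simp only [limits, pow_two]
  have : 2 * (A.length + B.length + 2) ≤
    (A.length + B.length + 2) * (A.length + B.length + 2) := Nat.mul_le_mul_right _ (by omega)
  omega

theorem cell_lt (A B : List ℕ) {i k j : ℕ} (hi : i ≤ A.length + B.length + 1) (hk : k < 16)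
    (hj : j ≤ A.length + B.length + 1) :
    cell (A.length + B.length) i k j < (limits A B).space := by
  have h1 : i * 16 + k + 1 ≤ 16 * (A.length + B.length + 2) := by omega
  calc cell (A.length + B.length) i k j
      < (i * 16 + k + 1) * (A.length + B.length + 2) := by
        rw [cell, Nat.add_mul (i * 16 + k) 1]; omega
    _ ≤ 16 * (A.length + B.length + 2) * (A.length + B.length + 2) := Nat.mul_le_mul_right _ h1
    _ = _ := by simp only [limits]; ring

/-- The contents of the registers `0` to `26`, which are constant after the initialization. Most of
them hold their own numbers, so that such a register serves as a literal.

The other registers are used as follows: `30` and `31` are the indices of `A` and `B`, `32` and `33`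
the limits on them, `34` is the length of the path, `35` the size of the stack, `36` is `1` while the
search is going on, `40` to `48` are the parameters of an entry of the tables, and all registers from
`50` on are auxiliary. -/
def constants (A B : List ℕ) : ℕ → ℕ
  | 20 => A.length
  | 21 => B.length
  | 22 => A.length + B.length + 2
  | 23 => A.length + B.length
  | 24 => A.length + 2
  | 25 => A.length + 1
  | 26 => B.length + 1
  | r => r

/-- The constant registers are initialized, and the input is intact. -/
structure Env (A B : List ℕ) (s : State) : Prop where
  reg : ∀ r < 27, s.reg r = constants A B r
  mem : ∀ a < A.length + B.length + 2,
    s.mem a = (A.length :: B.length :: (A ++ B)).getD a 0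

theorem le_cell {n i k j : ℕ} (hk : 1 ≤ k) : n + 2 ≤ cell n i k j := by
  have : 1 * (n + 2) ≤ (i * 16 + k) * (n + 2) := Nat.mul_le_mul_right _ (by omega)
  unfold cell; omega

variable {A B : List ℕ} {s : State} {Q : State → Prop}

theorem Env.of_eq {s' : State} (h : Env A B s) (hr : ∀ r < 27, s'.reg r = s.reg r)
    (hm : ∀ a < A.length + B.length + 2, s'.mem a = s.mem a) : Env A B s' :=
  ⟨fun r hlt => (hr r hlt).trans (h.reg r hlt), fun a ha => (hm a ha).trans (h.mem a ha)⟩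

theorem Env.setReg (h : Env A B s) {r : ℕ} (hr : 27 ≤ r) (v : ℕ) : Env A B (s.setReg r v) :=
  h.of_eq (fun q hq => by rw [State.reg_setReg, if_neg (by omega)]) (fun _ _ => rfl)

@[simp] theorem env_setReg_iff {r v : ℕ} (hr : 27 ≤ r) : Env A B (s.setReg r v) ↔ Env A B s :=
  ⟨fun h => h.of_eq (fun q hq => by rw [State.reg_setReg, if_neg (by omega)]) (fun _ _ => rfl),
    fun h => h.setReg hr v⟩

theorem Env.setMem (h : Env A B s) {i k j : ℕ} (hk : 1 ≤ k) (v : ℕ) :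
    Env A B (s.setMem (cell (A.length + B.length) i k j) v) :=
  h.of_eq (fun _ _ => rfl) (fun a ha => by
    have := le_cell (n := A.length + B.length) (i := i) (j := j) hk
    rw [State.mem_setMem, if_neg (by omega)])

/-- The string `X` is stored from the address `b` on. -/
def StringAt (n : ℕ) (s : State) (b : ℕ) (X : List ℕ) : Prop :=
  b + X.length ≤ n + 2 ∧ ∀ x < X.length, s.mem (b + x) = X.getD x 0

theorem Env.stringAt_left (h : Env A B s) : StringAt (A.length + B.length) s 2 A := by
  refine ⟨by omega, fun x hx => ?_⟩
  rw [h.mem _ (by omega), show 2 + x = x + 1 + 1 by omega]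
  simp [List.getElem?_append_left hx]

theorem Env.stringAt_right (h : Env A B s) :
    StringAt (A.length + B.length) s (A.length + 2) B := by
  refine ⟨by omega, fun x hx => ?_⟩
  rw [h.mem _ (by omega),
    show A.length + 2 + x = (A.length + x) + 1 + 1 by omega]
  simp [List.getElem?_append_right]

/-- An instruction without effect. -/
def nop : Prog := .instr (.move 99 99)

/-- `r := X[x]` for the string `X` at address `b` -/
def readSymbol (r b x : ℕ) : Prog := .instr (.add 99 b x) ⨾ .instr (.load r 99)

/-- Register `99` receives the address of the cell with row `i`, kind `k` and column `j`. -/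
def address (i k j : ℕ) : Prog :=
  .instr (.mul 99 i 16) ⨾ .instr (.add 99 99 k) ⨾ .instr (.mul 99 99 22) ⨾ .instr (.add 99 99 j)

/-- `r := cell i k j` -/
def readCell (r i k j : ℕ) : Prog := address i k j ⨾ .instr (.load r 99)

/-- `cell i k j := v` -/
def writeCell (i k j v : ℕ) : Prog := address i k j ⨾ .instr (.store 99 v)

theorem lt_word {A B : List ℕ} {v : ℕ} (h : v ≤ 4 * (A.length + B.length + 2)) :
    v < (limits A B).word := by
  have h1 := space_le_word A B
  have h2 := le_space A B
  omega

theorem wp_readSymbol {X : List ℕ} {r b x vb vx : ℕ} (hb : s.reg b = vb) (hvx : s.reg x = vx)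
    (hX : StringAt (A.length + B.length) s vb X) (hx : vx < X.length)
    (hQ : Q ((s.setReg 99 (vb + vx)).setReg r (X.getD vx 0))) :
    wp (limits A B) (readSymbol r b x) Q s := by
  subst hb hvx
  have h1 := hX.1
  have h2 := le_space A B
  simp only [readSymbol, wp_seq, wp_add, wp_load, State.reg_setReg, State.mem_setReg, if_true]
  rw [hX.2 _ hx]
  exact ⟨lt_word (by omega), by omega, hQ⟩

theorem wp_address {i k j vi vk vj : ℕ} (h : Env A B s) (ei : s.reg i = vi) (ek : s.reg k = vk)
    (ej : s.reg j = vj) (hi : vi ≤ A.length + B.length + 1) (hk : vk < 16)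
    (hj : vj ≤ A.length + B.length + 1) (hk' : k ≠ 99) (hj' : j ≠ 99)
    (hQ : Q (s.setReg 99 (cell (A.length + B.length) vi vk vj))) :
    wp (limits A B) (address i k j) Q s := by
  subst ei ek ej
  have h1 := cell_lt A B hi hk hj
  have h2 := space_le_word A B
  have h3 := h.reg 16 (by norm_num)
  have h4 := h.reg 22 (by norm_num)
  have h5 := le_space A B
  simp only [constants] at h3 h4
  simp only [address, wp_seq, wp_add, wp_mul, State.reg_setReg, if_true, h3, h4, hk', hj',
    if_false, State.setReg_setReg_same, if_neg (show (22 : ℕ) ≠ 99 by norm_num)]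
  unfold cell at *
  exact ⟨by omega, by omega, by omega, by omega, hQ⟩

theorem wp_readCell {r i k j vi vk vj : ℕ} (h : Env A B s) (ei : s.reg i = vi)
    (ek : s.reg k = vk) (ej : s.reg j = vj) (hi : vi ≤ A.length + B.length + 1) (hk : vk < 16)
    (hj : vj ≤ A.length + B.length + 1) (hk' : k ≠ 99) (hj' : j ≠ 99)
    (hQ : Q ((s.setReg 99 (cell (A.length + B.length) vi vk vj)).setReg r
      (s.mem (cell (A.length + B.length) vi vk vj)))) :
    wp (limits A B) (readCell r i k j) Q s := by
  refine wp_address h ei ek ej hi hk hj hk' hj' ?_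
  simp only [wp_load, State.reg_setReg, State.mem_setReg, if_true]
  exact ⟨cell_lt A B hi hk hj, hQ⟩

theorem wp_writeCell {i k j v vi vk vj : ℕ} (h : Env A B s) (ei : s.reg i = vi)
    (ek : s.reg k = vk) (ej : s.reg j = vj) (hi : vi ≤ A.length + B.length + 1) (hk : vk < 16)
    (hj : vj ≤ A.length + B.length + 1) (hk' : k ≠ 99) (hj' : j ≠ 99) (hv : v ≠ 99)
    (hQ : Q ((s.setReg 99 (cell (A.length + B.length) vi vk vj)).setMem
      (cell (A.length + B.length) vi vk vj) (s.reg v))) :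
    wp (limits A B) (writeCell i k j v) Q s := by
  refine wp_address h ei ek ej hi hk hj hk' hj' ?_
  simp only [wp_store, State.reg_setReg, if_true, if_neg hv]
  exact ⟨cell_lt A B hi hk hj, hQ⟩

/-- Register `60` receives `1` if the strings with lengths in the registers `lX` and `lY` and with
addresses in `bX` and `bY` have the same symbol at the indices in `x` and `y`, and `0` otherwise. -/
def meetTest (lX bX lY bY x y : ℕ) : Prog :=
  .instr (.const 60 0) ⨾ .cond (.lt x lX) (.cond (.lt y lY)
    (readSymbol 97 bX x ⨾ readSymbol 98 bY y ⨾ .cond (.eq 97 98) (.instr (.const 60 1)) nop)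
    nop) nop

theorem StringAt.of_mem_eq {n b : ℕ} {X : List ℕ} {s' : State} (h : StringAt n s b X)
    (hm : ∀ a < n + 2, s'.mem a = s.mem a) : StringAt n s' b X :=
  ⟨h.1, fun x hx => by rw [hm _ (by have := h.1; omega), h.2 x hx]⟩

theorem wp_meetTest {X Y : List ℕ} {lX bX lY bY x y vbX vbY vx vy : ℕ}
    (elX : s.reg lX = X.length) (elY : s.reg lY = Y.length) (ebX : s.reg bX = vbX)
    (ebY : s.reg bY = vbY) (ex : s.reg x = vx) (ey : s.reg y = vy)
    (hX : StringAt (A.length + B.length) s vbX X) (hY : StringAt (A.length + B.length) s vbY Y)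
    (hr : lX < 60 ∧ bX < 60 ∧ lY < 60 ∧ bY < 60 ∧ x < 60 ∧ y < 60)
    (hQ : ∀ s' : State, s'.mem = s.mem → s'.cur = s.cur → s'.out = s.out →
      (∀ r < 60, s'.reg r = s.reg r) → s'.reg 60 = (if Meet X Y vx vy then 1 else 0) → Q s') :
    wp (limits A B) (meetTest lX bX lY bY x y) Q s := by
  obtain ⟨r1, r2, r3, r4, r5, r6⟩ := hr
  simp only [meetTest, nop, wp_seq, wp_const, wp_cond_lt, State.reg_setReg, r1.ne,
    r3.ne, r5.ne, r6.ne, if_false, elX, elY, ex, ey, wp_move]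
  have hw : ∀ v, v ≤ 1 → v < (limits A B).word := fun v hv => lt_word (by omega)
  refine ⟨hw _ (by omega), fun hx => ⟨fun hy => ?_, fun hy => ?_⟩, fun hx => ?_⟩
  · refine wp_readSymbol (vb := vbX) (vx := vx) (by simp [r2.ne, ebX]) (by simp [r5.ne, ex])
      (hX.of_mem_eq fun _ _ => rfl) hx ?_
    refine wp_readSymbol (vb := vbY) (vx := vy)
      (by simp [r4.ne, ebY, (show bY ≠ 99 by omega), (show bY ≠ 97 by omega)])
      (by simp [r6.ne, ey, (show y ≠ 99 by omega), (show y ≠ 97 by omega)])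
      (hY.of_mem_eq fun _ _ => rfl) hy ?_
    simp only [wp_cond_eq, wp_const, wp_move, State.reg_setReg, if_true,
      if_neg (show (97 : ℕ) ≠ 98 by norm_num), if_neg (show (97 : ℕ) ≠ 99 by norm_num)]
    refine ⟨fun h => ⟨hw _ le_rfl, hQ _ rfl rfl rfl ?_ ?_⟩, fun h => hQ _ rfl rfl rfl ?_ ?_⟩
    · intro r hr
      simp only [State.reg_setReg]
      rw [if_neg, if_neg, if_neg, if_neg, if_neg, if_neg] <;> omega
    · simp only [State.reg_setReg, if_true]
      rw [if_pos ⟨hx, hy, h⟩]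
    · intro r hr
      simp only [State.reg_setReg]
      rw [if_neg, if_neg, if_neg, if_neg, if_neg, if_neg] <;> omega
    · simp [show ¬ Meet X Y vx vy from fun hm => h hm.2.2]
  · refine hQ _ rfl rfl rfl ?_ ?_
    · intro r hr
      simp only [State.reg_setReg]
      rw [if_neg, if_neg] <;> omega
    · simp [show ¬ Meet X Y vx vy from fun hm => hy hm.2.1]
  · refine hQ _ rfl rfl rfl ?_ ?_
    · intro r hr
      simp only [State.reg_setReg]
      rw [if_neg, if_neg] <;> omega
    · simp [show ¬ Meet X Y vx vy from fun hm => hx hm.1]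

/-! ### Computing an entry of the tables -/

/-- The data for the computation of one entry of each table: the strings `X` and `Y` are `A` and
`B` in one of the two orders, the entry belongs to the indices `x` and `y`, and the tables of
thresholds for `(X, Y)` and for `(Y, X)` and the table of deadlines have the kinds `e`, `e'`
and `d`. -/
structure EntryEnv (A B X Y : List ℕ) (x y e e' d : ℕ) (s : State) : Prop extends Env A B s where
  lenX : s.reg 40 = X.length
  strX : StringAt (A.length + B.length) s (s.reg 41) X
  lenY : s.reg 42 = Y.length
  strY : StringAt (A.length + B.length) s (s.reg 43) Y
  r44 : s.reg 44 = x
  r45 : s.reg 45 = y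
  r46 : s.reg 46 = e
  r47 : s.reg 47 = e'
  r48 : s.reg 48 = d
  length_add : X.length + Y.length = A.length + B.length
  hx : x ≤ X.length
  hy : y ≤ Y.length
  he : e < 16
  he' : e' < 16
  hd : d < 16

variable {X Y : List ℕ} {x y e e' d : ℕ}

theorem EntryEnv.of_eq {s' : State} (h : EntryEnv A B X Y x y e e' d s)
    (hr : ∀ r < 50, s'.reg r = s.reg r)
    (hm : ∀ a < A.length + B.length + 2, s'.mem a = s.mem a) :
    EntryEnv A B X Y x y e e' d s' where
  toEnv := h.toEnv.of_eq (fun r hlt => hr r (by omega)) hm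
  lenX := by rw [hr _ (by norm_num), h.lenX]
  strX := by rw [hr _ (by norm_num)]; exact h.strX.of_mem_eq hm
  lenY := by rw [hr _ (by norm_num), h.lenY]
  strY := by rw [hr _ (by norm_num)]; exact h.strY.of_mem_eq hm
  r44 := by rw [hr _ (by norm_num), h.r44]
  r45 := by rw [hr _ (by norm_num), h.r45]
  r46 := by rw [hr _ (by norm_num), h.r46]
  r47 := by rw [hr _ (by norm_num), h.r47]
  r48 := by rw [hr _ (by norm_num), h.r48]
  length_add := h.length_add
  hx := h.hx
  hy := h.hy
  he := h.he
  he' := h.he'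
  hd := h.hd

theorem EntryEnv.setReg (h : EntryEnv A B X Y x y e e' d s) {r : ℕ} (hr : 50 ≤ r) (v : ℕ) :
    EntryEnv A B X Y x y e e' d (s.setReg r v) :=
  h.of_eq (fun q hq => by rw [State.reg_setReg, if_neg (by omega)]) (fun _ _ => rfl)

@[simp] theorem entryEnv_setReg_iff {r v : ℕ} (hr : 50 ≤ r) :
    EntryEnv A B X Y x y e e' d (s.setReg r v) ↔ EntryEnv A B X Y x y e e' d s :=
  ⟨fun h => h.of_eq (fun q hq => by rw [State.reg_setReg, if_neg (by omega)]) (fun _ _ => rfl),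
    fun h => h.setReg hr v⟩

/-- One turn of the computation of a deadline; the registers `50`, `51` and `52` hold the two
indices of `X` and the index of `Y`. At the end of `Y` the second index is made equal to the first,
which ends the loop. -/
def deadlineTurn : Prog :=
  .cond (.lt 52 42)
    (readSymbol 53 43 52 ⨾ readSymbol 54 41 51 ⨾
      .cond (.eq 54 53) (.instr (.add 51 51 1)) nop ⨾
      .cond (.lt 50 40)
        (readSymbol 54 41 50 ⨾ .cond (.eq 54 53) (.instr (.add 50 50 1)) nop) nop ⨾
      .instr (.add 52 52 1))
    (.instr (.add 52 42 1) ⨾ .instr (.move 51 50))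

/-- The computation of `deadline X Y x (x - 1) y` in register `52`. -/
def computeDeadline : Prog :=
  (.instr (.move 50 44) ⨾ .instr (.sub 51 44 1) ⨾ .instr (.move 52 45)) ⨾
    .loop (.lt 51 50) deadlineTurn

theorem wp_deadlineTurn {pX pA pY : ℕ} (h : EntryEnv A B X Y x y e e' d s)
    (h50 : s.reg 50 = pX) (h51 : s.reg 51 = pA) (h52 : s.reg 52 = pY)
    (hX : pX ≤ X.length) (hA : pA < pX) (hY : pY ≤ Y.length) :
    wp (limits A B) deadlineTurn (fun s' => EntryEnv A B X Y x y e e' d s' ∧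
      s'.mem = s.mem ∧ s'.reg 50 ≤ X.length ∧ s'.reg 51 ≤ s'.reg 50 ∧
      (s'.reg 51 < s'.reg 50 → s'.reg 52 ≤ Y.length) ∧
      pY < s'.reg 52 ∧
      deadline X Y (s'.reg 50) (s'.reg 51) (s'.reg 52) = deadline X Y pX pA pY) s := by
  have c := h.reg
  have hl := h.length_add
  have c1 : s.reg 1 = 1 := c 1 (by norm_num)
  have hw : ∀ v, v ≤ A.length + B.length + 1 → v < (limits A B).word :=
    fun v hv => lt_word (by omega)
  have hD := deadline.eq_1 X Y pX pA pY
  rw [if_pos hA] at hD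
  simp only [deadlineTurn, wp_cond_lt, wp_seq, h.lenY, h52]
  constructor
  · intro hlt
    rw [if_pos hlt] at hD
    refine wp_readSymbol rfl h52 h.strY hlt ?_
    refine wp_readSymbol (by simp) (by simpa using h51) h.strX (by omega) ?_
    by_cases h1 : X.getD pA 0 = Y.getD pY 0 <;> by_cases h2 : pX < X.length
    · simp [-List.getD_eq_getElem?_getD, nop, wp_cond_eq, c1, h50, h51, h52, h.lenX, h1, h2,
        hw (pA + 1) (by omega)]
      refine wp_readSymbol (by simp) (by simpa using h50) h.strX h2 ?_
      by_cases h3 : X.getD pX 0 = Y.getD pY 0 <;>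
        simp [-List.getD_eq_getElem?_getD, c1, h50, h52, h, hD, h1, h2, h3,
          hw (pX + 1) (by omega), hw (pY + 1) (by omega)] <;> omega
    · simp [-List.getD_eq_getElem?_getD, nop, wp_cond_eq, c1, h50, h51, h52, h.lenX, h1, h2, h, hD,
        hw (pA + 1) (by omega), hw (pY + 1) (by omega)]
      omega
    · simp [-List.getD_eq_getElem?_getD, nop, wp_cond_eq, c1, h50, h51, h52, h.lenX, h1, h2]
      refine wp_readSymbol (by simp) (by simpa using h50) h.strX h2 ?_
      by_cases h3 : X.getD pX 0 = Y.getD pY 0 <;>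
        simp [-List.getD_eq_getElem?_getD, c1, h50, h51, h52, h, hD, h1, h2, h3,
          hw (pX + 1) (by omega), hw (pY + 1) (by omega)] <;> omega
    · simp [-List.getD_eq_getElem?_getD, nop, wp_cond_eq, c1, h50, h51, h52, h.lenX, h1, h2, h, hD,
        hw (pY + 1) (by omega)]
      omega
  · intro hge
    rw [if_neg hge] at hD
    simp [c1, h50, h.lenY, h, hD, hw (Y.length + 1) (by omega)]
    rw [deadline, if_neg (by omega)]
    omega

theorem runs_computeDeadline (h : EntryEnv A B X Y x y e e' d s) :
    Runs (limits A B) computeDeadline s (40 * (A.length + B.length + 2))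
      (fun s' => EntryEnv A B X Y x y e e' d s' ∧ s'.mem = s.mem ∧
        s'.reg 52 = deadline X Y x (x - 1) y) := by
  have c1 : s.reg 1 = 1 := h.reg 1 (by norm_num)
  have hx := h.hx
  have hy := h.hy
  have hl := h.length_add
  have hw : ∀ v, v ≤ A.length + B.length + 1 → v < (limits A B).word :=
    fun v hv => lt_word (by omega)
  have start : wp (limits A B)
      (.instr (.move 50 44) ⨾ .instr (.sub 51 44 1) ⨾ .instr (.move 52 45))
      (fun s' => EntryEnv A B X Y x y e e' d s' ∧ s'.mem = s.mem ∧ s'.reg 50 = x ∧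
        s'.reg 51 = x - 1 ∧ s'.reg 52 = y) s := by
    simp [h.r44, h.r45, c1, h, hw (x - 1) (by omega)]
  refine (Runs.of_wp start).seq (N' := (Y.length + 1 - y) * (deadlineTurn.cost + 1) + 1) ?_ ?_
  · rintro s1 ⟨h1, m1, h50, h51, h52⟩
    refine (Runs.loop (c := deadlineTurn.cost) (fun k s' => EntryEnv A B X Y x y e e' d s' ∧
      s'.mem = s.mem ∧ s'.reg 50 ≤ X.length ∧ s'.reg 51 ≤ s'.reg 50 ∧
      (s'.reg 51 < s'.reg 50 → s'.reg 52 ≤ Y.length) ∧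
      deadline X Y (s'.reg 50) (s'.reg 51) (s'.reg 52) = deadline X Y x (x - 1) y ∧
      k = Y.length + 1 - s'.reg 52) ?_ ?_).mono le_rfl ?_
    · rintro k s2 ⟨i1, m2, i2, i3, i4, i5, rfl⟩ hb
      have hb' : s2.reg 51 < s2.reg 50 := by simpa [Test.eval] using hb
      refine (Runs.of_wp (wp_deadlineTurn i1 rfl rfl rfl i2 hb' (i4 hb'))).mono le_rfl ?_
      rintro s3 ⟨j1, m3, j2, j3, j4, j5, j6⟩
      have := i4 hb'
      exact ⟨_, by omega, j1, m3.trans m2, j2, j3, j4, j6.trans i5, rfl⟩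
    · rw [h50, h51, h52]
      exact ⟨h1, m1, hx, by omega, fun _ => hy, rfl, rfl⟩
    · rintro s2 ⟨⟨k, i1, m2, i2, i3, i4, i5, -⟩, hb⟩
      have hb' : ¬ s2.reg 51 < s2.reg 50 := by simpa [Test.eval] using hb
      rw [deadline, if_neg hb'] at i5
      exact ⟨i1, m2, i5⟩
  · have e1 : deadlineTurn.cost ≤ 30 := by decide
    have e2 : (Y.length + 1 - y) * (deadlineTurn.cost + 1) ≤ (A.length + B.length + 1) * 31 :=
      Nat.mul_le_mul (by omega) (by omega)
    simp only [Prog.cost]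
    omega

/-- The registers `57` and `58` run to the end of the diagonal; register `60` is `1` as long as it is
not known to be reached. -/
def computeDiagonal : Prog :=
  (.instr (.move 57 44) ⨾ .instr (.move 58 45) ⨾ .instr (.const 60 1)) ⨾
    .loop (.lt 0 60) (meetTest 40 41 42 43 57 58 ⨾
      .cond (.lt 0 60) (.instr (.add 57 57 1) ⨾ .instr (.add 58 58 1)) nop)

theorem runs_computeDiagonal (h : EntryEnv A B X Y x y e e' d s) :
    Runs (limits A B) computeDiagonal s (40 * (A.length + B.length + 2))
      (fun s' => EntryEnv A B X Y x y e e' d s' ∧ s'.mem = s.mem ∧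
        s'.reg 57 = (diagonalEnd X Y x y).1 ∧ s'.reg 58 = (diagonalEnd X Y x y).2) := by
  have hx := h.hx
  have hy := h.hy
  have hl := h.length_add
  have hw : ∀ v, v ≤ A.length + B.length + 1 → v < (limits A B).word :=
    fun v hv => lt_word (by omega)
  have start : wp (limits A B)
      (.instr (.move 57 44) ⨾ .instr (.move 58 45) ⨾ .instr (.const 60 1))
      (fun s' => EntryEnv A B X Y x y e e' d s' ∧ s'.mem = s.mem ∧ s'.reg 57 = x ∧
        s'.reg 58 = y ∧ s'.reg 60 = 1) s := by
    simp [h.r44, h.r45, h, hw 1 (by omega)]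
  refine (Runs.of_wp start).seq (N' := (X.length + 1 - x) * (29 + 1) + 1) ?_ ?_
  · rintro s1 ⟨h1, hm, h57, h58, h60⟩
    refine (Runs.loop (c := 29) (fun k s' => EntryEnv A B X Y x y e e' d s' ∧ s'.mem = s.mem ∧
      s'.reg 57 ≤ X.length ∧ s'.reg 58 ≤ Y.length ∧
      diagonalEnd X Y (s'.reg 57) (s'.reg 58) = diagonalEnd X Y x y ∧
      (s'.reg 60 = 0 → diagonalEnd X Y x y = (s'.reg 57, s'.reg 58)) ∧ s'.reg 60 ≤ 1 ∧
      k = X.length - s'.reg 57 + s'.reg 60) ?_ (k := X.length + 1 - x) ?_).mono le_rfl ?_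
    · rintro k s2 ⟨i1, i0, i2, i3, i4, i5, i6, rfl⟩ hb
      have c := i1.reg
      have c0 : s2.reg 0 = 0 := c 0 (by norm_num)
      have c1 : s2.reg 1 = 1 := c 1 (by norm_num)
      have hb' : 0 < s2.reg 60 := by simpa [Test.eval, c0] using hb
      refine Runs.of_wp_le ?_ (show _ ≤ 29 by decide)
      refine wp_meetTest i1.lenX i1.lenY rfl rfl rfl rfl i1.strX i1.strY (by norm_num) ?_
      intro s3 m3 _ _ r3 f3
      have j1 : EntryEnv A B X Y x y e e' d s3 :=
        i1.of_eq (fun r hr => r3 r (by omega)) (fun _ _ => by rw [m3])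
      rw [diagonalEnd] at i4
      split_ifs at f3 i4 with hmeet
      · have := hmeet.1
        have := hmeet.2.1
        simp [r3, f3, c0, c1, j1, m3, i0, i4, hw _ (show s2.reg 57 + 1 ≤ _ by omega),
          hw _ (show s2.reg 58 + 1 ≤ _ by omega)]
        omega
      · simp [r3, f3, c0, c1, j1, nop, m3, i0, i4]
        exact ⟨hb', i2, i3, by rw [diagonalEnd, if_neg hmeet, i4]⟩
    · rw [h57, h58, h60]
      exact ⟨h1, hm, hx, hy, rfl, by simp, le_rfl, by omega⟩
    · rintro s2 ⟨⟨k, i1, i0, i2, i3, i4, i5, -, -⟩, hb⟩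
      have c0 : s2.reg 0 = 0 := i1.reg 0 (by norm_num)
      have hb' : s2.reg 60 = 0 := by simpa [Test.eval, c0] using hb
      rw [i5 hb']
      exact ⟨i1, i0, rfl, rfl⟩
  · have e2 : (X.length + 1 - x) * 30 ≤ (A.length + B.length + 1) * 30 :=
      Nat.mul_le_mul (by omega) (by omega)
    simp only [Prog.cost]
    omega

/-- The threshold is computed from later entries and from the deadline, which register `55`
holds. -/
def computeThreshold : Prog :=
  .instr (.add 59 57 58) ⨾
  .cond (.eq 59 23) (.instr (.move 54 44))
    (.instr (.add 59 58 1) ⨾ readCell 54 59 47 57 ⨾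
      .cond (.lt 54 55) (.instr (.move 54 44))
        (.instr (.add 59 57 1) ⨾ readCell 54 59 46 58)) ⨾
  writeCell 44 46 45 54

/-- The computation of the entries of both tables for `x` and `y`. -/
def computeEntry : Prog :=
  computeDeadline ⨾ (writeCell 44 48 45 52 ⨾ .instr (.move 55 52)) ⨾ computeDiagonal ⨾
    computeThreshold

theorem wp_computeThreshold (h : EntryEnv A B X Y x y e e' d s)
    (h55 : s.reg 55 = deadline X Y x (x - 1) y) (h57 : s.reg 57 = (diagonalEnd X Y x y).1)
    (h58 : s.reg 58 = (diagonalEnd X Y x y).2)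
    (hT : ∀ x' y', x ≤ x' → x' ≤ X.length → y ≤ y' → y' ≤ Y.length →
      s.mem (cell (A.length + B.length) (x' + 1) e y') = threshold X Y (x' + 1) y' ∧
      s.mem (cell (A.length + B.length) (y' + 1) e' x') = threshold Y X (y' + 1) x') :
    wp (limits A B) computeThreshold (fun s' =>
      s'.mem = Function.update s.mem (cell (A.length + B.length) x e y) (threshold X Y x y)) s := by
  have c1 : s.reg 1 = 1 := h.reg 1 (by norm_num)
  have c23 : s.reg 23 = A.length + B.length := h.reg 23 (by norm_num)
  have hx := h.hx
  have hy := h.hy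
  have hl := h.length_add
  have hw : ∀ v, v ≤ 4 * (A.length + B.length + 2) → v < (limits A B).word :=
    fun v hv => lt_word hv
  obtain ⟨d1, d2, d3, d4, -, -⟩ := diagonalEnd_spec X Y x y hx hy
  have ht := threshold.eq_1 X Y x y
  rw [dif_neg (by omega)] at ht
  generalize (diagonalEnd X Y x y).1 = x' at *
  generalize (diagonalEnd X Y x y).2 = y' at *
  obtain ⟨t1, t2⟩ := hT x' y' d1 d3 d2 d4
  have fin : ∀ (s' : State), EntryEnv A B X Y x y e e' d s' → s'.mem = s.mem →
      s'.reg 54 = threshold X Y x y → wp (limits A B) (writeCell 44 46 45 54) (fun s' =>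
      s'.mem = Function.update s.mem (cell (A.length + B.length) x e y) (threshold X Y x y)) s' := by
    intro s' h' hm h54
    refine wp_writeCell h'.toEnv h'.r44 h'.r46 h'.r45 (by omega) h.he (by omega) (by norm_num)
      (by norm_num) (by norm_num) ?_
    rw [h54, ← hm]
    rfl
  simp only [computeThreshold, wp_seq, wp_add, h57, h58, wp_cond_eq, State.reg_setReg, if_true,
    if_neg (show (23 : ℕ) ≠ 59 by norm_num), c23, wp_move]
  refine ⟨hw _ (by omega), fun he => ?_, fun he => ?_⟩
  · rw [if_pos (by omega)] at ht
    exact fin _ (by simp [h]) (by simp) (by simp [h.r44, ht])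
  · rw [if_neg (by omega)] at ht
    simp [c1]
    refine ⟨hw _ (by omega), ?_⟩
    refine wp_readCell (vi := y' + 1) (vk := e') (vj := x')
      (by simp [h.toEnv]) (by simp) (by simp [h.r47]) (by simp [h57]) (by omega) h.he' (by omega)
      (by norm_num) (by norm_num) ?_
    simp [h57, c1, h55, t2]
    refine ⟨fun hlt => ?_, fun hge => ?_⟩
    · rw [if_pos hlt] at ht
      exact fin _ (by simp [h]) (by simp) (by simp [h.r44, ht])
    · rw [if_neg (by omega)] at ht
      refine ⟨hw _ (by omega), ?_⟩
      refine wp_readCell (vi := x' + 1) (vk := e) (vj := y')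
        (by simp [h.toEnv]) (by simp) (by simp [h.r46]) (by simp [h58]) (by omega) h.he (by omega)
        (by norm_num) (by norm_num) ?_
      exact fin _ (by simp [h]) (by simp) (by simp [t1, ht])

theorem runs_computeEntry (h : EntryEnv A B X Y x y e e' d s) (h1d : 1 ≤ d)
    (hT : ∀ x' y', x ≤ x' → x' ≤ X.length → y ≤ y' → y' ≤ Y.length →
      s.mem (cell (A.length + B.length) (x' + 1) e y') = threshold X Y (x' + 1) y' ∧
      s.mem (cell (A.length + B.length) (y' + 1) e' x') = threshold Y X (y' + 1) x') :
    Runs (limits A B) computeEntry s (200 * (A.length + B.length + 2)) (fun s' =>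
      s'.mem = Function.update (Function.update s.mem (cell (A.length + B.length) x d y)
        (deadline X Y x (x - 1) y)) (cell (A.length + B.length) x e y) (threshold X Y x y)) := by
  have hx := h.hx
  have hy := h.hy
  have hl := h.length_add
  refine (runs_computeDeadline h).seq (N' := 100 * (A.length + B.length + 2)) ?_ (by omega)
  rintro s1 ⟨h1, m1, h52⟩
  refine (Runs.of_wp_le (N := 20) (Q := fun s' => EntryEnv A B X Y x y e e' d s' ∧
    s'.mem = Function.update s.mem (cell (A.length + B.length) x d y) (deadline X Y x (x - 1) y) ∧
    s'.reg 55 = deadline X Y x (x - 1) y) ?_ (by decide)).seq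
    (N' := 80 * (A.length + B.length + 2)) ?_ (by omega)
  · refine wp_writeCell h1.toEnv h1.r44 h1.r48 h1.r45 (by omega) h.hd (by omega) (by norm_num)
      (by norm_num) (by norm_num) ?_
    simp only [wp_move]
    refine ⟨?_, ?_, ?_⟩
    · refine h1.of_eq (fun r hr => ?_) (fun a ha => ?_)
      · simp [show r ≠ 55 by omega, show r ≠ 99 by omega]
      · have := le_cell (n := A.length + B.length) (i := x) (k := d) (j := y) h1d
        simp; omega
    · simp [State.setMem, State.setReg, h52, m1]
    · simp [h52]
  · rintro s2 ⟨h2, m2, h55⟩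
    refine ((runs_computeDiagonal h2).frame (b := 57) (by decide)).seq
      (N' := 39 * (A.length + B.length + 2)) ?_ (by omega)
    rintro s3 ⟨⟨h3, m3, h57, h58⟩, f3⟩
    refine (Runs.of_wp_le (wp_computeThreshold h3 ?_ h57 h58 ?_)
      (N := 39) (by decide)).mono (by omega) ?_
    · rw [f3 55 (by norm_num), h55]
    · intro x' y' q1 q2 q3 q4
      rw [m3, m2, Function.update_of_ne, Function.update_of_ne]
      · exact hT x' y' q1 q2 q3 q4
      · rw [Ne, cell_inj h.he' (by omega) h.hd (by omega)]; omega
      · rw [Ne, cell_inj h.he (by omega) h.hd (by omega)]; omega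
    · intro s4 h4
      rw [h4, m3, m2]

/-! ### Filling the tables -/

/-- The registers `40` to `48` are prepared for entries that belong to `(A, B)`. -/
def prepareLeft : Prog :=
  .instr (.move 40 20) ⨾ .instr (.move 41 2) ⨾ .instr (.move 42 21) ⨾ .instr (.move 43 24) ⨾
  .instr (.move 44 30) ⨾ .instr (.move 45 31) ⨾ .instr (.move 46 1) ⨾ .instr (.move 47 2) ⨾
  .instr (.move 48 3)

/-- The registers `40` to `48` are prepared for entries that belong to `(B, A)`. -/
def prepareRight : Prog :=
  .instr (.move 40 21) ⨾ .instr (.move 41 24) ⨾ .instr (.move 42 20) ⨾ .instr (.move 43 2) ⨾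
  .instr (.move 44 31) ⨾ .instr (.move 45 30) ⨾ .instr (.move 46 2) ⨾ .instr (.move 47 1) ⨾
  .instr (.move 48 4)

theorem wp_prepareLeft (h : Env A B s) (h30 : s.reg 30 ≤ A.length) (h31 : s.reg 31 ≤ B.length) :
    wp (limits A B) prepareLeft (fun s' => s'.mem = s.mem ∧
      EntryEnv A B A B (s.reg 30) (s.reg 31) 1 2 3 s') s := by
  have c := h.reg
  simp only [prepareLeft, wp_seq, wp_move]
  refine ⟨rfl, ?_⟩
  constructor <;> simp [c, constants, h30, h31, h]
  · exact h.stringAt_left.of_mem_eq (fun _ _ => rfl)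
  · exact h.stringAt_right.of_mem_eq (fun _ _ => rfl)

theorem wp_prepareRight (h : Env A B s) (h30 : s.reg 30 ≤ A.length) (h31 : s.reg 31 ≤ B.length) :
    wp (limits A B) prepareRight (fun s' => s'.mem = s.mem ∧
      EntryEnv A B B A (s.reg 31) (s.reg 30) 2 1 4 s') s := by
  have c := h.reg
  simp only [prepareRight, wp_seq, wp_move]
  refine ⟨rfl, ?_⟩
  constructor <;> simp [c, constants, h30, h31, h, add_comm]
  · exact h.stringAt_right.of_mem_eq (fun _ _ => rfl)
  · exact h.stringAt_left.of_mem_eq (fun _ _ => rfl)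

/-- The tables are correct at the indices `i` of `A` and `j` of `B`: thresholds are in the kinds
`1` and `2`, deadlines in the kinds `3` and `4`. -/
structure Filled (A B : List ℕ) (mem : ℕ → ℕ) (i j : ℕ) : Prop where
  threshold_left : j ≤ B.length → mem (cell (A.length + B.length) i 1 j) = threshold A B i j
  threshold_right : i ≤ A.length → mem (cell (A.length + B.length) j 2 i) = threshold B A j i
  deadline_left : i ≤ A.length → j ≤ B.length →
    mem (cell (A.length + B.length) i 3 j) = deadline A B i (i - 1) j
  deadline_right : i ≤ A.length → j ≤ B.length →
    mem (cell (A.length + B.length) j 4 i) = deadline B A j (j - 1) i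

/-- The tables are correct at all indices that come after `i` and `j` in lexicographic order, and
on the boundary. -/
def FilledFrom (A B : List ℕ) (mem : ℕ → ℕ) (i j : ℕ) : Prop :=
  ∀ i' j', i' ≤ A.length + 1 → j' ≤ B.length + 1 →
    (i < i' ∨ i = i' ∧ j ≤ j' ∨ A.length < i' ∨ B.length < j') → Filled A B mem i' j'

/-- Register `31` is decreased by one, and the entries that belong to the new indices are
computed. -/
def fillEntries : Prog :=
  .instr (.sub 31 31 1) ⨾ (prepareLeft ⨾ computeEntry) ⨾ (prepareRight ⨾ computeEntry)

theorem runs_fillEntries {i j : ℕ} (h : Env A B s) (hi : i ≤ A.length) (hj : j ≤ B.length)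
    (h30 : s.reg 30 = i) (h31 : s.reg 31 = j + 1) (hF : FilledFrom A B s.mem i (j + 1)) :
    Runs (limits A B) fillEntries s (500 * (A.length + B.length + 2)) (fun s' =>
      Env A B s' ∧ s'.reg 30 = i ∧ s'.reg 31 = j ∧ FilledFrom A B s'.mem i j) := by
  have c1 : s.reg 1 = 1 := h.reg 1 (by norm_num)
  have start : wp (limits A B) (.instr (.sub 31 31 1)) (fun s' => Env A B s' ∧ s'.mem = s.mem ∧
      s'.reg 30 = i ∧ s'.reg 31 = j) s := by
    simp [h, h30, h31, c1]
    exact lt_word (by omega)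
  refine (Runs.of_wp_le start le_rfl).seq (N' := 450 * (A.length + B.length + 2)) ?_
    (by simp only [Prog.cost]; omega)
  rintro s1 ⟨h1, m1, h30, h31⟩
  have hl : Runs (limits A B) (prepareLeft ⨾ computeEntry) s1 (221 * (A.length + B.length + 2))
      (fun s' => s'.mem = Function.update (Function.update s.mem
        (cell (A.length + B.length) i 3 j) (deadline A B i (i - 1) j))
        (cell (A.length + B.length) i 1 j) (threshold A B i j)) := by
    refine (Runs.of_wp_le (N := 20) (wp_prepareLeft h1 (by omega) (by omega)) (by decide)).seq
      (N' := 200 * (A.length + B.length + 2)) ?_ (by omega)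
    rintro s2 ⟨m2, h2⟩
    rw [h30, h31] at h2
    rw [← m1, ← m2]
    refine runs_computeEntry h2 (by norm_num) ?_
    intro x' y' q1 q2 q3 q4
    rw [m2, m1]
    exact ⟨(hF (x' + 1) y' (by omega) (by omega) (by omega)).threshold_left q4,
      (hF x' (y' + 1) (by omega) (by omega) (by omega)).threshold_right q2⟩
  refine (hl.frame (b := 40) (by decide)).seq (N' := 221 * (A.length + B.length + 2)) ?_
    (by omega)
  rintro s2 ⟨m2, f2⟩
  have hne : ∀ a < A.length + B.length + 2, s2.mem a = s1.mem a := by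
    intro a ha
    have e1 := le_cell (n := A.length + B.length) (i := i) (k := 1) (j := j) le_rfl
    have e2 := le_cell (n := A.length + B.length) (i := i) (k := 3) (j := j) (by norm_num)
    rw [m2, m1, Function.update_of_ne (by omega), Function.update_of_ne (by omega)]
  have h2 : Env A B s2 := h1.of_eq (fun r hr => f2 r (by omega)) hne
  rw [← f2 30 (by norm_num)] at h30
  rw [← f2 31 (by norm_num)] at h31
  have hr : Runs (limits A B) (prepareRight ⨾ computeEntry) s2 (221 * (A.length + B.length + 2))
      (fun s' => s'.mem = Function.update (Function.update s2.mem
        (cell (A.length + B.length) j 4 i) (deadline B A j (j - 1) i))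
        (cell (A.length + B.length) j 2 i) (threshold B A j i)) := by
    refine (Runs.of_wp_le (N := 20) (wp_prepareRight h2 (by omega) (by omega)) (by decide)).seq
      (N' := 200 * (A.length + B.length + 2)) ?_ (by omega)
    rintro s3 ⟨m3, h3⟩
    rw [h30, h31] at h3
    rw [← m3]
    refine runs_computeEntry h3 (by norm_num) ?_
    intro y' x' q1 q2 q3 q4
    rw [m3, m2]
    constructor
    · rw [Function.update_of_ne, Function.update_of_ne]
      · exact (hF x' (y' + 1) (by omega) (by omega) (by omega)).threshold_right q4
      all_goals rw [Ne, cell_inj] <;> omega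
    · rw [Function.update_of_ne, Function.update_of_ne]
      · exact (hF (x' + 1) y' (by omega) (by omega) (by omega)).threshold_left q2
      all_goals rw [Ne, cell_inj] <;> omega
  refine (hr.frame (b := 40) (by decide)).mono le_rfl ?_
  rintro s3 ⟨m3, f3⟩
  refine ⟨h2.of_eq (fun r hr => f3 r (by omega)) ?_, (f3 30 (by norm_num)).trans h30,
    (f3 31 (by norm_num)).trans h31, ?_⟩
  · intro a ha
    have e1 := le_cell (n := A.length + B.length) (i := j) (k := 2) (j := i) (by norm_num)
    have e2 := le_cell (n := A.length + B.length) (i := j) (k := 4) (j := i) (by norm_num)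
    rw [m3, Function.update_of_ne (by omega), Function.update_of_ne (by omega)]
  · rw [m3, m2]
    intro i' j' hi' hj' hlex
    by_cases he : i' = i ∧ j' = j
    · obtain ⟨rfl, rfl⟩ := he
      constructor <;> intros <;> simp (disch := omega) [Function.update_apply, cell_inj]
    · have hF' := hF i' j' hi' hj' (by omega)
      constructor
      · intro q
        rw [← hF'.threshold_left q]
        simp (disch := omega) [Function.update_apply, cell_inj]; omega
      · intro q
        rw [← hF'.threshold_right q]
        simp (disch := omega) [Function.update_apply, cell_inj]; omega
      · intro q q'
        rw [← hF'.deadline_left q q']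
        simp (disch := omega) [Function.update_apply, cell_inj]; omega
      · intro q q'
        rw [← hF'.deadline_right q q']
        simp (disch := omega) [Function.update_apply, cell_inj]; omega

/-- The thresholds for indices beyond the end of the respective first string are set to their common
value, in both tables. -/
def fillBoundary : Prog :=
  (.instr (.move 31 26) ⨾ .loop (.lt 0 31) (.instr (.sub 31 31 1) ⨾ writeCell 25 1 31 25)) ⨾
  (.instr (.move 30 25) ⨾ .loop (.lt 0 30) (.instr (.sub 30 30 1) ⨾ writeCell 26 2 30 26))

/-- One of the two loops of `fillBoundary`. -/
theorem runs_fillBoundaryLoop {q i k N vi : ℕ} (h : Env A B s)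
    (hq : 27 ≤ q ∧ q < 99) (hi : s.reg i = vi) (hi' : i < 27) (hvi : vi ≤ A.length + B.length + 1)
    (hk : 1 ≤ k ∧ k ≤ 15) (hck : constants A B k = k) (hk' : k < 27) (hN : s.reg q = N)
    (hN' : N ≤ A.length + B.length + 2) :
    Runs (limits A B) (.loop (.lt 0 q) (.instr (.sub q q 1) ⨾ writeCell i k q i)) s
      (30 * (A.length + B.length + 2) + 1) (fun s' => Env A B s' ∧
        (∀ y < N, s'.mem (cell (A.length + B.length) vi k y) = vi) ∧
        ∀ i' k' j', k' < 16 → k' ≠ k → j' < A.length + B.length + 2 →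
          s'.mem (cell (A.length + B.length) i' k' j') =
            s.mem (cell (A.length + B.length) i' k' j')) := by
  refine (Runs.loop (c := 29) (fun n s' => Env A B s' ∧ s'.reg q = n ∧ n ≤ N ∧
    s'.reg i = vi ∧
    (∀ y, n ≤ y → y < N → s'.mem (cell (A.length + B.length) vi k y) = vi) ∧
    ∀ i' k' j', k' < 16 → k' ≠ k → j' < A.length + B.length + 2 →
      s'.mem (cell (A.length + B.length) i' k' j') =
        s.mem (cell (A.length + B.length) i' k' j')) ?_
    ⟨h, hN, le_rfl, hi, fun y h1 h2 => by omega, fun _ _ _ _ _ _ => rfl⟩).mono ?_ ?_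
  · rintro n s1 ⟨h1, hn, hnN, hi1, hc, ho⟩ hb
    have c0 : s1.reg 0 = 0 := h1.reg 0 (by norm_num)
    have c1 : s1.reg 1 = 1 := h1.reg 1 (by norm_num)
    have hb' : 0 < n := by simpa [Test.eval, c0, hn] using hb
    refine Runs.of_wp_le ?_ (show _ ≤ 29 from (by decide : 11 ≤ 29))
    simp only [wp_seq, wp_sub, hn, c1]
    refine ⟨lt_word (by omega), ?_⟩
    have hkq : s1.reg k = k := (h1.reg k hk').trans hck
    refine wp_writeCell (vi := vi) (vk := k) (vj := n - 1) (h1.setReg hq.1 _)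
      (by simp [show i ≠ q by omega, hi1]) (by simp [show k ≠ q by omega, hkq]) (by simp)
      hvi (by omega) (by omega) (by omega) (by omega) (by omega) ?_
    simp only [State.reg_setReg, if_neg (show i ≠ q by omega), hi1]
    refine ⟨n - 1, by omega, ?_, ?_, by omega, ?_, ?_, ?_⟩
    · exact ((h1.setReg hq.1 _).setReg (by norm_num) _).setMem hk.1 _
    · simp [show q ≠ 99 by omega]
    · simp [show i ≠ 99 by omega, show i ≠ q by omega, hi1]
    · intro y hy1 hy2
      simp only [State.mem_setMem, State.mem_setReg]
      split_ifs with he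
      · rfl
      · refine hc y ?_ hy2
        rw [cell_inj (by omega) (by omega) (by omega) (by omega)] at he
        omega
    · intro i' k' j' q1 q2 q3
      simp only [State.mem_setMem, State.mem_setReg]
      rw [if_neg, ho i' k' j' q1 q2 q3]
      rw [cell_inj q1 q3 (by omega) (by omega)]
      omega
  · have := Nat.mul_le_mul_right 30 hN'
    omega
  · rintro s1 ⟨⟨n, h1, hn, hnN, hi1, hc, ho⟩, hb⟩
    have c0 : s1.reg 0 = 0 := h1.reg 0 (by norm_num)
    have hb' : n = 0 := by simpa [Test.eval, c0, hn] using hb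
    exact ⟨h1, fun y hy => hc y (by omega) hy, ho⟩

theorem runs_fillBoundary (h : Env A B s) :
    Runs (limits A B) fillBoundary s (100 * (A.length + B.length + 2)) (fun s' =>
      Env A B s' ∧ FilledFrom A B s'.mem (A.length + 1) 0) := by
  have c26 : ∀ s : State, Env A B s → s.reg 26 = B.length + 1 := fun s h => h.reg 26 (by norm_num)
  have c25 : ∀ s : State, Env A B s → s.reg 25 = A.length + 1 := fun s h => h.reg 25 (by norm_num)
  refine Runs.seq (N := 40 * (A.length + B.length + 2)) (N' := 40 * (A.length + B.length + 2))
    (Q := fun s' => Env A B s' ∧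
    ∀ y < B.length + 1, s'.mem (cell (A.length + B.length) (A.length + 1) 1 y) = A.length + 1)
    ?_ ?_ (by omega)
  · refine (Runs.of_wp_le (N := 1) (Q := fun s' => Env A B s' ∧ s'.reg 31 = B.length + 1)
      ?_ le_rfl).seq (N' := 30 * (A.length + B.length + 2) + 1) ?_ (by omega)
    · simp [h, c26]
    · rintro s1 ⟨h1, h31⟩
      refine (runs_fillBoundaryLoop h1 (by norm_num) (c25 _ h1) (by norm_num) (by omega)
        (by norm_num) rfl (by norm_num) h31 (by omega)).mono le_rfl ?_
      rintro s2 ⟨h2, h3, -⟩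
      exact ⟨h2, h3⟩
  · rintro s1 ⟨h1, h1'⟩
    refine (Runs.of_wp_le (N := 1) (Q := fun s' => (Env A B s' ∧ s'.mem = s1.mem) ∧
      s'.reg 30 = A.length + 1) ?_ le_rfl).seq (N' := 30 * (A.length + B.length + 2) + 1) ?_
      (by omega)
    · simp [h1, c25]
    · rintro s2 ⟨⟨h2, m2⟩, h30⟩
      refine (runs_fillBoundaryLoop h2 (by norm_num) (c26 _ h2) (by norm_num) (by omega)
        (by norm_num) rfl (by norm_num) h30 (by omega)).mono le_rfl ?_
      rintro s3 ⟨h3, h4, h5⟩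
      refine ⟨h3, fun i j hi hj hor => ⟨fun q => ?_, fun q => ?_, fun q q' => ?_, fun q q' => ?_⟩⟩
      · obtain rfl : i = A.length + 1 := by omega
        rw [h5 _ _ _ (by norm_num) (by norm_num) (by omega), m2, h1' _ (by omega),
          threshold_of_gt (by omega)]
      · obtain rfl : j = B.length + 1 := by omega
        rw [h4 _ (by omega), threshold_of_gt (by omega)]
      · omega
      · omega

/-- Register `30` is decreased by one, and the entries for this index of `A` are computed. -/
def fillRow : Prog :=
  (.instr (.sub 30 30 1) ⨾ .instr (.move 31 26)) ⨾ .loop (.lt 0 31) fillEntries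

theorem runs_fillRow {i : ℕ} (h : Env A B s) (hi : i ≤ A.length) (h30 : s.reg 30 = i + 1)
    (hF : FilledFrom A B s.mem (i + 1) 0) :
    Runs (limits A B) fillRow s (600 * (A.length + B.length + 2) ^ 2) (fun s' =>
      Env A B s' ∧ s'.reg 30 = i ∧ FilledFrom A B s'.mem i 0) := by
  have c1 : s.reg 1 = 1 := h.reg 1 (by norm_num)
  have c26 : s.reg 26 = B.length + 1 := h.reg 26 (by norm_num)
  have start : wp (limits A B) (.instr (.sub 30 30 1) ⨾ .instr (.move 31 26))
      (fun s' => Env A B s' ∧ s'.reg 30 = i ∧ s'.reg 31 = B.length + 1 ∧ s'.mem = s.mem) s := by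
    simp [h, h30, c1, c26]
    exact lt_word (by omega)
  refine (Runs.of_wp start).seq (N' := (B.length + 1) *
    (500 * (A.length + B.length + 2) + 1) + 1) ?_ ?_
  · rintro s1 ⟨h1, h30, h31, m1⟩
    refine (Runs.loop (c := 500 * (A.length + B.length + 2)) (fun k s' => Env A B s' ∧
      s'.reg 30 = i ∧ s'.reg 31 = k ∧ k ≤ B.length + 1 ∧ FilledFrom A B s'.mem i k) ?_
      ⟨h1, h30, h31, le_rfl, ?_⟩).mono le_rfl ?_
    · rintro k s2 ⟨h2, e30, e31, hk, hF2⟩ hb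
      have c0 : s2.reg 0 = 0 := h2.reg 0 (by norm_num)
      have hb' : 0 < k := by simpa [Test.eval, c0, e31] using hb
      obtain ⟨k, rfl⟩ := Nat.exists_eq_add_of_le' hb'
      refine (runs_fillEntries h2 hi (by omega) e30 e31 hF2).mono le_rfl ?_
      rintro s3 ⟨h3, f30, f31, hF3⟩
      exact ⟨k, by omega, h3, f30, f31, by omega, hF3⟩
    · intro i' j' hi' hj' hor
      rw [m1]
      exact hF i' j' hi' hj' (by omega)
    · rintro s2 ⟨⟨k, h2, e30, e31, hk, hF2⟩, hb⟩
      have c0 : s2.reg 0 = 0 := h2.reg 0 (by norm_num)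
      have hb' : k = 0 := by simpa [Test.eval, c0, e31] using hb
      subst hb'
      exact ⟨h2, e30, hF2⟩
  · have : (B.length + 1) * (500 * (A.length + B.length + 2) + 1) ≤
      (A.length + B.length + 2) * (501 * (A.length + B.length + 2)) :=
        Nat.mul_le_mul (by omega) (by omega)
    have h2 : 2 * 2 ≤ (A.length + B.length + 2) * (A.length + B.length + 2) :=
      Nat.mul_le_mul (by omega) (by omega)
    simp only [Prog.cost]
    nlinarith

/-- The computation of all tables. Both indices decrease, since thresholds depend on thresholds for
later indices. -/
def fillTables : Prog :=
  fillBoundary ⨾ .instr (.move 30 25) ⨾ .loop (.lt 0 30) fillRow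

theorem runs_fillTables (h : Env A B s) :
    Runs (limits A B) fillTables s (800 * (A.length + B.length + 2) ^ 3) (fun s' =>
      Env A B s' ∧ FilledFrom A B s'.mem 0 0) := by
  have hN : 2 ≤ A.length + B.length + 2 := by omega
  have hA : A.length + 1 ≤ A.length + B.length + 2 := by omega
  refine (runs_fillBoundary h).seq (N' := 1 + ((A.length + 1) *
    (600 * (A.length + B.length + 2) ^ 2 + 1) + 1) + 1) ?_ ?_
  · rintro s1 ⟨h1, hF1⟩
    refine (Runs.of_wp_le (N := 1) (Q := fun s' => Env A B s' ∧ s'.reg 30 = A.length + 1 ∧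
      s'.mem = s1.mem) ?_ le_rfl).seq (N' := ((A.length + 1) *
      (600 * (A.length + B.length + 2) ^ 2 + 1) + 1)) ?_ (by omega)
    · simp [h1, h1.reg, constants]
    · rintro s2 ⟨h2, h30, m2⟩
      refine (Runs.loop (c := 600 * (A.length + B.length + 2) ^ 2) (fun k s' => Env A B s' ∧
        s'.reg 30 = k ∧ k ≤ A.length + 1 ∧ FilledFrom A B s'.mem k 0) ?_
        ⟨h2, h30, le_rfl, m2 ▸ hF1⟩).mono le_rfl ?_
      · rintro k s2 ⟨h2, e30, hk, hF2⟩ hb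
        have c0 : s2.reg 0 = 0 := h2.reg 0 (by norm_num)
        have hb' : 0 < k := by simpa [Test.eval, c0, e30] using hb
        obtain ⟨k, rfl⟩ := Nat.exists_eq_add_of_le' hb'
        refine (runs_fillRow h2 (by omega) e30 hF2).mono le_rfl ?_
        rintro s3 ⟨h3, f30, hF3⟩
        exact ⟨k, by omega, h3, f30, by omega, hF3⟩
      · rintro s2 ⟨⟨k, h2, e30, hk, hF2⟩, hb⟩
        have c0 : s2.reg 0 = 0 := h2.reg 0 (by norm_num)
        have hb' : k = 0 := by simpa [Test.eval, c0, e30] using hb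
        subst hb'
        exact ⟨h2, hF2⟩
  · generalize A.length + B.length + 2 = N at *
    have h1 := Nat.mul_le_mul hA (le_refl (600 * N ^ 2 + 1))
    have h2 : N * 2 ≤ N * N := Nat.mul_le_mul le_rfl hN
    have h3 : N * N * 2 ≤ N * N * N := Nat.mul_le_mul le_rfl hN
    have e : N ^ 3 = N * N * N := by ring
    have e' : N * (600 * N ^ 2 + 1) = 600 * (N * N * N) + N := by ring
    rw [e]
    rw [e'] at h1
    omega

/-- The initialization of the constant registers. -/
def initRegisters : Prog :=
  (.instr (.const 1 1) ⨾ .instr (.const 2 2) ⨾ .instr (.const 3 3) ⨾ .instr (.const 4 4) ⨾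
  .instr (.const 5 5) ⨾ .instr (.const 6 6) ⨾ .instr (.const 7 7) ⨾ .instr (.const 8 8) ⨾
  .instr (.const 9 9) ⨾ .instr (.const 10 10) ⨾ .instr (.const 11 11) ⨾ .instr (.const 12 12) ⨾
  .instr (.const 13 13) ⨾ .instr (.const 14 14) ⨾ .instr (.const 15 15) ⨾ .instr (.const 16 16) ⨾
  .instr (.const 17 17) ⨾ .instr (.const 18 18) ⨾ .instr (.const 19 19)) ⨾
  .instr (.load 20 0) ⨾ .instr (.load 21 1) ⨾ .instr (.add 23 20 21) ⨾ .instr (.add 22 23 2) ⨾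
  .instr (.add 24 20 2) ⨾ .instr (.add 25 20 1) ⨾ .instr (.add 26 21 1)

theorem runs_initRegisters :
    Runs (limits A B) initRegisters (State.init A B) 100 (Env A B) := by
  have hw : ∀ v, v ≤ 4 * (A.length + B.length + 2) → v < (limits A B).word :=
    fun v hv => lt_word hv
  have hsp := le_space A B
  have hsw := space_le_word A B
  have hc : ∀ k, k < 20 → k < (limits A B).word := fun k hk => by omega
  refine Runs.of_wp_le ?_ (by decide)
  simp only [initRegisters, wp_seq, wp_const]
  iterate 19 refine ⟨hc _ (by norm_num), ?_⟩
  simp [State.init]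
  refine ⟨by omega, by omega, hw _ (by omega), hw _ (by omega), hw _ (by omega), hw _ (by omega),
    hw _ (by omega), ?_⟩
  constructor
  · intro r hr
    interval_cases r <;> simp [constants]
  · intro a ha
    simp

end WordRAM

/-! ### The search -/

namespace MinSuperseq

/-- The condition under which a step in `X` alone is to be taken, by one comparison with the table. -/
theorem exists_completion_left_iff (X Y : List ℕ) {x y I : ℕ} (hx : x ≤ X.length)
    (hy : y ≤ Y.length) (hI : I ≤ X.length + 1) :
    threshold X Y (x + 1) y < I ↔ (x < X.length ∧ x + 1 < I) ∧
      ∃ S, S ∈ completions X Y (x + 1) y I (deadline X Y (x + 1) x y) := by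
  have hle := le_threshold X Y (x + 1) y (by omega)
  constructor
  · intro h
    have hx' : x < X.length := by
      by_contra hc
      rw [threshold_of_gt (by omega)] at h
      omega
    exact ⟨⟨hx', by omega⟩,
      (exists_completion_iff X Y (x + 1) y I hx' hy (by omega) hI).2 h⟩
  · rintro ⟨⟨h1, h2⟩, h3⟩
    exact (exists_completion_iff X Y (x + 1) y I h1 hy h2 hI).1 h3

theorem exists_completion_right_iff (X Y : List ℕ) {x y J : ℕ} (hx : x ≤ X.length)
    (hy : y ≤ Y.length) (hJ : J ≤ Y.length + 1) :
    threshold Y X (y + 1) x < J ↔ (y < Y.length ∧ y + 1 < J) ∧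
      ∃ S, S ∈ completions X Y x (y + 1) (deadline Y X (y + 1) y x) J := by
  rw [exists_completion_left_iff Y X hy hx hJ]
  simp only [mem_completions_comm Y X]

/-- The recursion for the completions with a test that excludes dead ends. -/
theorem completions_eq_of_not_meet {X Y : List ℕ} {x y I J : ℕ} (h : ¬ Meet X Y x y)
    (he : ¬ (x = X.length ∧ y = Y.length)) (hx : x ≤ X.length) (hy : y ≤ Y.length)
    (hI : I ≤ X.length + 1) (hJ : J ≤ Y.length + 1) :
    completions X Y x y I J =
    (if threshold X Y (x + 1) y < I then
      (completions X Y (x + 1) y I (deadline X Y (x + 1) x y)).map (X.getD x 0 :: ·) else []) ++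
    (if threshold Y X (y + 1) x < J then
      (completions X Y x (y + 1) (deadline Y X (y + 1) y x) J).map (Y.getD y 0 :: ·) else []) := by
  have key : ∀ (p q : Prop) [Decidable p] [Decidable q] (l : List (List ℕ)) (c : ℕ),
      (q ↔ p ∧ ∃ S, S ∈ l) →
      (if p then l.map (c :: ·) else []) = if q then l.map (c :: ·) else [] := by
    intro p q _ _ l c hpq
    by_cases hp : p
    · by_cases hq : q
      · rw [if_pos hp, if_pos hq]
      · have : l = [] := List.eq_nil_iff_forall_not_mem.2 fun S hS => hq (hpq.2 ⟨hp, S, hS⟩)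
        rw [if_pos hp, if_neg hq, this, List.map_nil]
    · rw [if_neg hp, if_neg (fun hq => hp (hpq.1 hq).1)]
  rw [completions_of_not_meet h he]
  congr 1
  · exact key _ _ _ _ (exists_completion_left_iff X Y hx hy hI)
  · exact key _ _ _ _ (exists_completion_right_iff X Y hx hy hJ)

/-- A node of the search tree at which the step in `B` alone has been put off: the arguments of
`completions` and the path that leads to the node. -/
structure Frame where
  i : ℕ
  j : ℕ
  I : ℕ
  J : ℕ
  path : List ℕ

variable {A B : List ℕ}

/-- The supersequences that the postponed step at a node leads to. -/
def Frame.postponed (A B : List ℕ) (f : Frame) : List (List ℕ) :=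
  (completions A B f.i (f.j + 1) (deadline B A (f.j + 1) f.j f.i) f.J).map
    (f.path ++ [B.getD f.j 0] ++ ·)

/-- The indices and limits of the node are in range, and there is a completion after its postponed
step. -/
structure Frame.Valid (A B : List ℕ) (f : Frame) : Prop where
  hi : f.i ≤ A.length
  hj : f.j ≤ B.length
  hI : f.I ≤ A.length + 1
  hJ : f.J ≤ B.length + 1
  length_path : f.path.length ≤ f.i + f.j
  right : threshold B A (f.j + 1) f.i < f.J

/-- A stack of nodes, the topmost first, that lie in this order on the path `p`. -/
def Chain (A B : List ℕ) : List ℕ → List Frame → Prop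
  | _, [] => True
  | p, f :: stk => f.path <+: p ∧ f.path.length < p.length ∧ f.Valid A B ∧ Chain A B f.path stk

theorem Chain.length_le {p : List ℕ} {stk : List Frame} (h : Chain A B p stk) :
    stk.length ≤ p.length := by
  induction stk generalizing p with
  | nil => exact Nat.zero_le _
  | cons f stk ih =>
    have h1 := ih h.2.2.2
    have h2 := h.2.1
    simp only [List.length_cons]; omega

theorem Chain.append {p : List ℕ} {stk : List Frame} (h : Chain A B p stk) (c : ℕ) :
    Chain A B (p ++ [c]) stk := by
  cases stk with
  | nil => trivial
  | cons f stk =>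
    refine ⟨h.1.trans (List.prefix_append _ _), ?_, h.2.2⟩
    have := h.2.1
    simp only [List.length_append, List.length_singleton]; omega

/-- The invariant of the search: it is at a node below which there is a completion, and `total`
consists of the supersequences `out` found so far, of those below the node, and of those that the
postponed steps lead to. -/
structure Search (A B : List ℕ) (total out : List (List ℕ)) (f : Frame) (stk : List Frame) :
    Prop where
  hi : f.i ≤ A.length
  hj : f.j ≤ B.length
  hI : f.I ≤ A.length + 1
  hJ : f.J ≤ B.length + 1
  length_path : f.path.length ≤ f.i + f.j
  chain : Chain A B f.path stk
  total_eq : total = out ++ (completions A B f.i f.j f.I f.J).map (f.path ++ ·) ++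
    stk.flatMap (Frame.postponed A B)
  live : ∃ S, S ∈ completions A B f.i f.j f.I f.J

/-- The node after a step in both strings. -/
def Frame.both (A : List ℕ) (f : Frame) : Frame :=
  ⟨f.i + 1, f.j + 1, f.I, f.J, f.path ++ [A.getD f.i 0]⟩

/-- The node after a step in `A` alone. -/
def Frame.left (A B : List ℕ) (f : Frame) : Frame :=
  ⟨f.i + 1, f.j, f.I, deadline A B (f.i + 1) f.i f.j, f.path ++ [A.getD f.i 0]⟩

/-- The node after a step in `B` alone. -/
def Frame.right (A B : List ℕ) (f : Frame) : Frame :=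
  ⟨f.i, f.j + 1, deadline B A (f.j + 1) f.j f.i, f.J, f.path ++ [B.getD f.j 0]⟩

variable {total out : List (List ℕ)} {f : Frame} {stk : List Frame}

theorem Search.start (A B : List ℕ) :
    Search A B (completions A B 0 0 (A.length + 1) (B.length + 1)) []
      ⟨0, 0, A.length + 1, B.length + 1, []⟩ [] where
  hi := Nat.zero_le _
  hj := Nat.zero_le _
  hI := le_rfl
  hJ := le_rfl
  length_path := le_rfl
  chain := trivial
  total_eq := by simp
  live := by
    obtain ⟨S, hS⟩ := exists_isMinimal A B
    exact ⟨S, (mem_completions_start_iff A B S).2 hS⟩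

theorem Search.both (h : Search A B total out f stk) (hm : Meet A B f.i f.j) :
    Search A B total out (f.both A) stk where
  hi := hm.1
  hj := hm.2.1
  hI := h.hI
  hJ := h.hJ
  length_path := by
    have := h.length_path
    simp only [Frame.both, List.length_append, List.length_singleton]; omega
  chain := h.chain.append _
  total_eq := by
    rw [h.total_eq, completions_of_meet hm, List.map_map]
    simp [Frame.both, Function.comp_def]
  live := by
    obtain ⟨S, hS⟩ := h.live
    rw [completions_of_meet hm] at hS
    obtain ⟨T, hT, -⟩ := List.mem_map.1 hS
    exact ⟨T, hT⟩

theorem Search.left (h : Search A B total out f stk) (hm : ¬ Meet A B f.i f.j)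
    (he : f.i + f.j < A.length + B.length) (hl : threshold A B (f.i + 1) f.j < f.I) :
    f.i < A.length ∧ Search A B total out (f.left A B)
      (if threshold B A (f.j + 1) f.i < f.J then f :: stk else stk) := by
  have hc := completions_eq_of_not_meet hm (by omega) h.hi h.hj h.hI h.hJ
  obtain ⟨⟨hx, -⟩, hlive⟩ := (exists_completion_left_iff A B h.hi h.hj h.hI).1 hl
  refine ⟨hx, ⟨hx, h.hj, h.hI, deadline_le _ _ _ _ _ h.hj, ?_, ?_, ?_, hlive⟩⟩
  · have := h.length_path
    simp only [Frame.left, List.length_append, List.length_singleton]; omega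
  · split_ifs with hr
    · exact ⟨List.prefix_append _ _, by simp [Frame.left],
        ⟨h.hi, h.hj, h.hI, h.hJ, h.length_path, hr⟩, h.chain⟩
    · exact h.chain.append _
  · rw [h.total_eq, hc, if_pos hl]
    split_ifs with hr <;> simp [Frame.left, Frame.postponed, Function.comp_def]

/-- The step that a valid frame has postponed. -/
theorem Frame.Valid.right_lt (h : f.Valid A B) : f.j < B.length :=
  ((exists_completion_right_iff A B h.hi h.hj h.hJ).1 h.right).1.1

theorem Search.of_right (hf : f.Valid A B) (hc : Chain A B f.path stk)
    (ht : total = out ++ f.postponed A B ++ stk.flatMap (Frame.postponed A B)) :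
    Search A B total out (f.right A B) stk where
  hi := hf.hi
  hj := hf.right_lt
  hI := deadline_le _ _ _ _ _ hf.hi
  hJ := hf.hJ
  length_path := by
    have := hf.length_path
    simp only [Frame.right, List.length_append, List.length_singleton]; omega
  chain := hc.append _
  total_eq := ht
  live := ((exists_completion_right_iff A B hf.hi hf.hj hf.hJ).1 hf.right).2

theorem Search.right (h : Search A B total out f stk) (hm : ¬ Meet A B f.i f.j)
    (he : f.i + f.j < A.length + B.length) (hl : ¬ threshold A B (f.i + 1) f.j < f.I) :
    f.j < B.length ∧ Search A B total out (f.right A B) stk := by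
  have hc := completions_eq_of_not_meet hm (by omega) h.hi h.hj h.hI h.hJ
  rw [if_neg hl, List.nil_append] at hc
  have hr : threshold B A (f.j + 1) f.i < f.J := by
    by_contra hr
    obtain ⟨S, hS⟩ := h.live
    rw [hc, if_neg hr] at hS
    simp at hS
  have hv : f.Valid A B := ⟨h.hi, h.hj, h.hI, h.hJ, h.length_path, hr⟩
  refine ⟨hv.right_lt, Search.of_right hv h.chain ?_⟩
  rw [h.total_eq, hc, if_pos hr]
  simp [Frame.postponed, Function.comp_def]

theorem Search.total_eq_of_end (h : Search A B total out f stk)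
    (he : A.length + B.length ≤ f.i + f.j) :
    total = out ++ [f.path] ++ stk.flatMap (Frame.postponed A B) := by
  have h1 := h.hi
  have h2 := h.hj
  have e1 : f.i = A.length := by omega
  have e2 : f.j = B.length := by omega
  have ht := h.total_eq
  rw [e1, e2, completions_end] at ht
  simpa using ht

theorem Search.pop {g : Frame} (h : Search A B total out f (g :: stk))
    (he : A.length + B.length ≤ f.i + f.j) :
    Search A B total (out ++ [f.path]) (g.right A B) stk :=
  Search.of_right h.chain.2.2.1 h.chain.2.2.2 (by rw [h.total_eq_of_end he]; simp)

end MinSuperseq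

namespace WordRAM

/-! ### The steps of the search on the machine -/

variable {A B : List ℕ} {s : State} {Q : State → Prop}

/-- The stack is stored in the kinds `5` to `9`, the bottom of the stack in column `0`. Of a path
only the length is stored, because it is a prefix of the current path. -/
def StackAt (n : ℕ) (mem : ℕ → ℕ) : List Frame → Prop
  | [] => True
  | f :: stk => mem (cell n 0 5 stk.length) = f.i ∧ mem (cell n 0 6 stk.length) = f.j ∧
      mem (cell n 0 7 stk.length) = f.I ∧ mem (cell n 0 8 stk.length) = f.J ∧
      mem (cell n 0 9 stk.length) = f.path.length ∧ StackAt n mem stk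

theorem StackAt.of_eq {n : ℕ} {mem mem' : ℕ → ℕ} {stk : List Frame} (h : StackAt n mem stk)
    (he : ∀ k j, 5 ≤ k → k ≤ 9 → j < stk.length → mem' (cell n 0 k j) = mem (cell n 0 k j)) :
    StackAt n mem' stk := by
  induction stk with
  | nil => trivial
  | cons f stk ih =>
    have hlt : stk.length < (f :: stk).length := by simp
    obtain ⟨h1, h2, h3, h4, h5, h6⟩ := h
    exact ⟨by rw [he 5 _ (by norm_num) (by norm_num) hlt, h1],
      by rw [he 6 _ (by norm_num) (by norm_num) hlt, h2],
      by rw [he 7 _ (by norm_num) (by norm_num) hlt, h3],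
      by rw [he 8 _ (by norm_num) (by norm_num) hlt, h4],
      by rw [he 9 _ (by norm_num) (by norm_num) hlt, h5],
      ih h6 fun k j hk hk' hj => he k j hk hk' (by simp only [List.length_cons]; omega)⟩

/-- The machine represents the node `f` and the stack `stk` of the search. -/
structure At (A B : List ℕ) (f : Frame) (stk : List Frame) (s : State) : Prop
    extends Env A B s where
  filled : FilledFrom A B s.mem 0 0
  stackAt : StackAt (A.length + B.length) s.mem stk
  path : ∀ k < f.path.length, s.mem (cell (A.length + B.length) 0 10 k) = f.path.getD k 0
  r30 : s.reg 30 = f.i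
  r31 : s.reg 31 = f.j
  r32 : s.reg 32 = f.I
  r33 : s.reg 33 = f.J
  r34 : s.reg 34 = f.path.length
  r35 : s.reg 35 = stk.length
  r36 : s.reg 36 = 1

variable {f : Frame} {stk : List Frame}

theorem At.of_eq {s' : State} (h : At A B f stk s) (hr : ∀ r < 60, s'.reg r = s.reg r)
    (hm : s'.mem = s.mem) : At A B f stk s' where
  toEnv := h.toEnv.of_eq (fun r hlt => hr r (by omega)) (fun _ _ => by rw [hm])
  filled := hm ▸ h.filled
  stackAt := hm ▸ h.stackAt
  path := hm ▸ h.path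
  r30 := by rw [hr _ (by norm_num), h.r30]
  r31 := by rw [hr _ (by norm_num), h.r31]
  r32 := by rw [hr _ (by norm_num), h.r32]
  r33 := by rw [hr _ (by norm_num), h.r33]
  r34 := by rw [hr _ (by norm_num), h.r34]
  r35 := by rw [hr _ (by norm_num), h.r35]
  r36 := by rw [hr _ (by norm_num), h.r36]

@[simp] theorem at_setReg_iff {r v : ℕ} (hr : 60 ≤ r) :
    At A B f stk (s.setReg r v) ↔ At A B f stk s :=
  ⟨fun h => h.of_eq (fun q hq => by rw [State.reg_setReg, if_neg (by omega)]) rfl,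
    fun h => h.of_eq (fun q hq => by rw [State.reg_setReg, if_neg (by omega)]) rfl⟩

theorem FilledFrom.of_eq {mem mem' : ℕ → ℕ} {i j : ℕ} (h : FilledFrom A B mem i j)
    (he : ∀ i k j, k ≤ 4 → j ≤ A.length + B.length + 1 →
      mem' (cell (A.length + B.length) i k j) = mem (cell (A.length + B.length) i k j)) :
    FilledFrom A B mem' i j := by
  intro i' j' hi hj hor
  have h' := h i' j' hi hj hor
  exact ⟨fun q => by rw [he _ _ _ (by norm_num) (by omega), h'.threshold_left q],
    fun q => by rw [he _ _ _ (by norm_num) (by omega), h'.threshold_right q],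
    fun q q' => by rw [he _ _ _ (by norm_num) (by omega), h'.deadline_left q q'],
    fun q q' => by rw [he _ _ _ (by norm_num) (by omega), h'.deadline_right q q']⟩

/-- The symbol with the index in `x` of the string at the address in `b` is appended to the path. -/
def pushSymbol (b x : ℕ) : Prog :=
  readSymbol 61 b x ⨾ writeCell 0 10 34 61 ⨾ .instr (.add 34 34 1)

/-- The effect of `pushSymbol` on everything but the indices. -/
theorem wp_pushSymbol {X : List ℕ} {b x vb vx : ℕ} (h : At A B f stk s) (hb : s.reg b = vb)
    (hvx : s.reg x = vx) (hX : StringAt (A.length + B.length) s vb X) (hx : vx < X.length)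
    (hp : f.path.length ≤ A.length + B.length) (hs : stk.length ≤ A.length + B.length)
    (hQ : ∀ s', At A B { f with path := f.path ++ [X.getD vx 0] } stk s' → Q s') :
    wp (limits A B) (pushSymbol b x) Q s := by
  have c0 : s.reg 0 = 0 := h.reg 0 (by norm_num)
  have c1 : s.reg 1 = 1 := h.reg 1 (by norm_num)
  have c10 : s.reg 10 = 10 := h.reg 10 (by norm_num)
  simp only [pushSymbol, wp_seq]
  refine wp_readSymbol hb hvx hX hx ?_
  refine wp_writeCell (vi := 0) (vk := 10) (vj := f.path.length) (by simp [h.toEnv]) (by simp [c0])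
    (by simp [c10]) (by simp [h.r34]) (by omega) (by norm_num) (by omega) (by norm_num)
    (by norm_num) (by norm_num) ?_
  simp only [wp_add, State.reg_setReg, State.reg_setMem]
  refine ⟨by simp [h.r34, c1]; exact lt_word (by omega), hQ _ ?_⟩
  constructor
  · refine Env.setReg (Env.setMem ?_ (by norm_num) _) (by norm_num) _
    simp [h.toEnv]
  · refine h.filled.of_eq fun i k j hk hj => ?_
    simp only [State.mem_setReg, State.mem_setMem]
    rw [if_neg]
    rw [cell_inj (by omega) (by omega) (by omega) (by omega)]; omega
  · refine h.stackAt.of_eq fun k j hk hk' hj => ?_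
    simp only [State.mem_setReg, State.mem_setMem]
    rw [if_neg]
    rw [cell_inj (by omega) (by omega) (by omega) (by omega)]; omega
  · intro k hk
    simp only [List.length_append, List.length_singleton] at hk
    simp only [State.mem_setReg, State.mem_setMem]
    by_cases he : k = f.path.length
    · simp [he]
    · rw [if_neg, h.path k (by omega), List.getD_append _ _ _ _ (by omega)]
      rw [cell_inj (by omega) (by omega) (by omega) (by omega)]; omega
  all_goals simp [h.r30, h.r31, h.r32, h.r33, h.r34, h.r35, h.r36, c1]

/-- The registers for the indices and the limits may be changed freely. -/
theorem At.setReg_index (h : At A B f stk s) (v : ℕ) :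
    At A B { f with i := v } stk (s.setReg 30 v) ∧ At A B { f with j := v } stk (s.setReg 31 v) ∧
    At A B { f with I := v } stk (s.setReg 32 v) ∧
    At A B { f with J := v } stk (s.setReg 33 v) := by
  refine ⟨?_, ?_, ?_, ?_⟩ <;> constructor <;>
    simp [h.toEnv, h.r30, h.r31, h.r32, h.r33, h.r34, h.r35, h.r36, h.filled, h.stackAt,
      -List.getD_eq_getElem?_getD] <;> exact h.path

/-- A step in both strings. -/
def stepBoth : Prog :=
  pushSymbol 2 30 ⨾ .instr (.add 30 30 1) ⨾ .instr (.add 31 31 1)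

/-- A step in `A` alone; the limit on the index of `B` is read from the table of deadlines. -/
def stepLeft : Prog :=
  pushSymbol 2 30 ⨾ .instr (.add 30 30 1) ⨾ readCell 33 30 3 31

/-- A step in `B` alone; the limit on the index of `A` is read from the table of deadlines. -/
def stepRight : Prog :=
  pushSymbol 24 31 ⨾ .instr (.add 31 31 1) ⨾ readCell 32 31 4 30

theorem wp_stepBoth (h : At A B f stk s) (hi : f.i < A.length) (hj : f.j < B.length)
    (hp : f.path.length ≤ A.length + B.length) (hs : stk.length ≤ A.length + B.length) :
    wp (limits A B) stepBoth (At A B (f.both A) stk) s := by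
  have hw : ∀ v, v ≤ 4 * (A.length + B.length + 2) → v < (limits A B).word :=
    fun v hv => lt_word hv
  simp only [stepBoth, wp_seq]
  refine wp_pushSymbol h (h.reg 2 (by norm_num)) h.r30 h.stringAt_left hi hp hs fun s1 h1 => ?_
  have c1 : s1.reg 1 = 1 := h1.reg 1 (by norm_num)
  have e30 := h1.r30
  have e31 := h1.r31
  simp only [wp_seq, wp_add, State.reg_setReg, c1]
  simp only [e30, e31, if_neg (show (31 : ℕ) ≠ 30 by norm_num),
    if_neg (show (1 : ℕ) ≠ 30 by norm_num)]
  exact ⟨hw _ (by omega), hw _ (by omega), (((h1.setReg_index _).1).setReg_index _).2.1⟩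

theorem wp_stepLeft (h : At A B f stk s) (hi : f.i < A.length) (hj : f.j ≤ B.length)
    (hp : f.path.length ≤ A.length + B.length) (hs : stk.length ≤ A.length + B.length) :
    wp (limits A B) stepLeft (At A B (f.left A B) stk) s := by
  have hw : ∀ v, v ≤ 4 * (A.length + B.length + 2) → v < (limits A B).word :=
    fun v hv => lt_word hv
  simp only [stepLeft, wp_seq]
  refine wp_pushSymbol h (h.reg 2 (by norm_num)) h.r30 h.stringAt_left hi hp hs fun s1 h1 => ?_
  have c1 : s1.reg 1 = 1 := h1.reg 1 (by norm_num)
  simp only [wp_seq, wp_add, c1, h1.r30]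
  refine ⟨hw _ (by omega), ?_⟩
  have h2 := (h1.setReg_index (f.i + 1)).1
  refine wp_readCell h2.toEnv h2.r30 (h2.reg 3 (by norm_num)) h2.r31
    (by simp only; omega) (by simp [constants]) (by simp only; omega) (by norm_num) (by norm_num) ?_
  have h3 := ((at_setReg_iff (r := 99) (v := cell (A.length + B.length) (f.i + 1) 3 f.j)
    (by norm_num)).2 h2)
  have hF := (h1.filled (f.i + 1) f.j (by omega) (by omega) (by omega)).deadline_left hi hj
  have h4 := (h3.setReg_index (deadline A B (f.i + 1) f.i f.j)).2.2.2
  rw [Nat.add_sub_cancel] at hF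
  rw [← hF] at h4
  simp only [Frame.left, ← hF]
  exact h4

theorem wp_stepRight (h : At A B f stk s) (hi : f.i ≤ A.length) (hj : f.j < B.length)
    (hp : f.path.length ≤ A.length + B.length) (hs : stk.length ≤ A.length + B.length) :
    wp (limits A B) stepRight (At A B (f.right A B) stk) s := by
  have hw : ∀ v, v ≤ 4 * (A.length + B.length + 2) → v < (limits A B).word :=
    fun v hv => lt_word hv
  simp only [stepRight, wp_seq]
  refine wp_pushSymbol h (h.reg 24 (by norm_num)) h.r31 h.stringAt_right hj hp hs fun s1 h1 => ?_
  have c1 : s1.reg 1 = 1 := h1.reg 1 (by norm_num)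
  simp only [wp_seq, wp_add, c1, h1.r31]
  refine ⟨hw _ (by omega), ?_⟩
  have h2 := (h1.setReg_index (f.j + 1)).2.1
  refine wp_readCell h2.toEnv h2.r31 (h2.reg 4 (by norm_num)) h2.r30
    (by simp only; omega) (by simp [constants]) (by simp only; omega) (by norm_num) (by norm_num) ?_
  have h3 := ((at_setReg_iff (r := 99) (v := cell (A.length + B.length) (f.j + 1) 4 f.i)
    (by norm_num)).2 h2)
  have hF := (h1.filled f.i (f.j + 1) (by omega) (by omega) (by omega)).deadline_right hi hj
  have h4 := (h3.setReg_index (deadline B A (f.j + 1) f.j f.i)).2.2.1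
  rw [Nat.add_sub_cancel] at hF
  rw [← hF] at h4
  simp only [Frame.right, ← hF]
  exact h4

/-- The current node is pushed on the stack. -/
def pushFrame : Prog :=
  writeCell 0 5 35 30 ⨾ writeCell 0 6 35 31 ⨾ writeCell 0 7 35 32 ⨾ writeCell 0 8 35 33 ⨾
  writeCell 0 9 35 34 ⨾ .instr (.add 35 35 1)

/-- The topmost node of the stack becomes the current node. -/
def popFrame : Prog :=
  .instr (.sub 35 35 1) ⨾ readCell 30 0 5 35 ⨾ readCell 31 0 6 35 ⨾ readCell 32 0 7 35 ⨾
  readCell 33 0 8 35 ⨾ readCell 34 0 9 35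

theorem wp_writeCell_stack {k v : ℕ} (h : Env A B s) (hk : k < 16) (hk5 : 5 ≤ k)
    (hs : s.reg 35 = stk.length) (hck : constants A B k = k)
    (hst : stk.length ≤ A.length + B.length) (hv : v < 60)
    (hQ : ∀ s', Env A B s' → (∀ r < 60, s'.reg r = s.reg r) →
      s'.mem = Function.update s.mem (cell (A.length + B.length) 0 k stk.length) (s.reg v) →
      Q s') : wp (limits A B) (writeCell 0 k 35 v) Q s := by
  have c0 : s.reg 0 = 0 := h.reg 0 (by norm_num)
  refine wp_writeCell h c0 ((h.reg k (by omega)).trans hck) hs (by omega) hk (by omega) (by omega)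
    (by norm_num) (by omega) (hQ _ ?_ ?_ rfl)
  · exact Env.setMem (by simp [h]) (by omega) _
  · intro r hr
    simp [show r ≠ 99 by omega]

theorem wp_pushFrame (h : At A B f stk s) (hp : f.path.length ≤ A.length + B.length)
    (hs : stk.length ≤ A.length + B.length) :
    wp (limits A B) pushFrame (At A B f (f :: stk)) s := by
  simp only [pushFrame, wp_seq]
  refine wp_writeCell_stack h.toEnv (by norm_num) (by norm_num) h.r35 rfl hs (by norm_num)
    fun s1 e1 q1 m1 => ?_
  refine wp_writeCell_stack e1 (by norm_num) (by norm_num) (by rw [q1 _ (by norm_num), h.r35])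
    rfl hs (by norm_num) fun s2 e2 q2 m2 => ?_
  refine wp_writeCell_stack e2 (by norm_num) (by norm_num)
    (by rw [q2 _ (by norm_num), q1 _ (by norm_num), h.r35])
    rfl hs (by norm_num) fun s3 e3 q3 m3 => ?_
  refine wp_writeCell_stack e3 (by norm_num) (by norm_num)
    (by rw [q3 _ (by norm_num), q2 _ (by norm_num), q1 _ (by norm_num), h.r35])
    rfl hs (by norm_num) fun s4 e4 q4 m4 => ?_
  refine wp_writeCell_stack e4 (by norm_num) (by norm_num)
    (by rw [q4 _ (by norm_num), q3 _ (by norm_num), q2 _ (by norm_num), q1 _ (by norm_num), h.r35])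
    rfl hs (by norm_num) fun s5 e5 q5 m5 => ?_
  have q : ∀ r < 60, s5.reg r = s.reg r := fun r hr => by
    rw [q5 r hr, q4 r hr, q3 r hr, q2 r hr, q1 r hr]
  have c1 : s5.reg 1 = 1 := e5.reg 1 (by norm_num)
  rw [m4, m3, m2, m1, q4 _ (by norm_num), q3 _ (by norm_num), q2 _ (by norm_num),
    q1 _ (by norm_num), q3 _ (by norm_num), q2 _ (by norm_num), q1 _ (by norm_num),
    q2 _ (by norm_num), q1 _ (by norm_num), q1 _ (by norm_num), h.r30, h.r31, h.r32, h.r33,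
    h.r34] at m5
  simp only [wp_add, c1]
  rw [q 35 (by norm_num), h.r35]
  refine ⟨lt_word (by omega), ?_⟩
  constructor
  · exact e5.setReg (by norm_num) _
  · refine h.filled.of_eq fun i k j hk hj => ?_
    simp (disch := omega) only [State.mem_setReg, m5, Function.update_apply, cell_inj]
    repeat rw [if_neg (by omega)]
  · simp only [State.mem_setReg, m5]
    refine ⟨?_, ?_, ?_, ?_, ?_, h.stackAt.of_eq fun k j hk hk' hj => ?_⟩
    all_goals simp (disch := omega) [Function.update_apply, cell_inj]
    repeat rw [if_neg (by omega)]
  · intro k hk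
    simp (disch := omega) only [State.mem_setReg, m5, Function.update_apply, cell_inj]
    repeat rw [if_neg (by omega)]
    exact h.path k hk
  all_goals simp [h.r30, h.r31, h.r32, h.r33, h.r34, h.r36, q]

theorem wp_readCell_stack {r k : ℕ} (h : Env A B s) (hk : k < 16)
    (hs : s.reg 35 = stk.length) (hck : constants A B k = k)
    (hst : stk.length ≤ A.length + B.length) (hr : 27 ≤ r)
    (hQ : ∀ s', Env A B s' → (∀ q < 60, q ≠ r → s'.reg q = s.reg q) →
      s'.reg r = s.mem (cell (A.length + B.length) 0 k stk.length) → s'.mem = s.mem →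
      Q s') : wp (limits A B) (readCell r 0 k 35) Q s := by
  have c0 : s.reg 0 = 0 := h.reg 0 (by norm_num)
  refine wp_readCell h c0 ((h.reg k (by omega)).trans hck) hs (by omega) hk (by omega) (by omega)
    (by norm_num) (hQ _ ?_ ?_ ?_ rfl)
  · simp [h, hr]
  · intro q hq hqr
    simp [show q ≠ 99 by omega, hqr]
  · simp

theorem wp_popFrame {g : Frame} (h : At A B g (f :: stk) s) (hp : f.path <+: g.path)
    (hs : stk.length ≤ A.length + B.length) :
    wp (limits A B) popFrame (At A B f stk) s := by
  have c1 : s.reg 1 = 1 := h.reg 1 (by norm_num)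
  obtain ⟨t1, t2, t3, t4, t5, t6⟩ := h.stackAt
  simp only [popFrame, wp_seq, wp_sub, h.r35, c1, List.length_cons, Nat.add_sub_cancel]
  refine ⟨lt_word (by omega), ?_⟩
  refine wp_readCell_stack (stk := stk) (h.setReg (by norm_num) _) (by norm_num) (by simp) rfl hs
    (by norm_num) fun s1 e1 q1 r1 m1 => ?_
  refine wp_readCell_stack (stk := stk) e1 (by norm_num) (by simp [q1]) rfl hs
    (by norm_num) fun s2 e2 q2 r2 m2 => ?_
  refine wp_readCell_stack (stk := stk) e2 (by norm_num) (by simp [q1, q2]) rfl hs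
    (by norm_num) fun s3 e3 q3 r3 m3 => ?_
  refine wp_readCell_stack (stk := stk) e3 (by norm_num) (by simp [q1, q2, q3]) rfl hs
    (by norm_num) fun s4 e4 q4 r4 m4 => ?_
  refine wp_readCell_stack (stk := stk) e4 (by norm_num) (by simp [q1, q2, q3, q4]) rfl hs
    (by norm_num) fun s5 e5 q5 r5 m5 => ?_
  have hm : s5.mem = s.mem := by rw [m5, m4, m3, m2, m1]; rfl
  constructor
  · exact e5
  · exact hm ▸ h.filled
  · exact hm ▸ t6
  · intro k hk
    have hle := hp.length_le
    rw [hm, h.path k (by omega)]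
    obtain ⟨t, ht⟩ := hp
    rw [← ht, List.getD_append _ _ _ _ hk]
  all_goals simp [q1, q2, q3, q4, q5, r1, r2, r3, r4, r5, m4, m3, m2, m1, t1, t2, t3, t4, t5, h.r36]

/-- One step down in the search tree. The comparisons of thresholds with limits tell which steps lead
to a completion; if both do, the one in `B` is postponed. -/
def advance : Prog :=
  meetTest 20 2 21 24 30 31 ⨾ .cond (.lt 0 60) stepBoth
    ((.instr (.add 61 30 1) ⨾ readCell 62 61 1 31 ⨾ .instr (.add 61 31 1) ⨾ readCell 63 61 2 30) ⨾
      .cond (.lt 62 32) (.cond (.lt 63 33) pushFrame nop ⨾ stepLeft) stepRight)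

theorem wp_advance {total out : List (List ℕ)} (h : At A B f stk s)
    (hS : Search A B total out f stk) (he : f.i + f.j < A.length + B.length) :
    wp (limits A B) advance (fun s' => ∃ f' stk', At A B f' stk' s' ∧
      Search A B total out f' stk' ∧ f.i + f.j < f'.i + f'.j) s := by
  have hw : ∀ v, v ≤ 4 * (A.length + B.length + 2) → v < (limits A B).word :=
    fun v hv => lt_word hv
  have hi := hS.hi
  have hj := hS.hj
  have hp := hS.length_path
  have hst := hS.chain.length_le
  simp only [advance, wp_seq]
  refine wp_meetTest (h.reg 20 (by norm_num)) (h.reg 21 (by norm_num)) (h.reg 2 (by norm_num))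
    (h.reg 24 (by norm_num)) h.r30 h.r31 h.stringAt_left h.stringAt_right (by norm_num) ?_
  intro s1 m1 _ _ f1 e1
  have h1 : At A B f stk s1 := h.of_eq f1 m1
  have c0 : s1.reg 0 = 0 := h1.reg 0 (by norm_num)
  have c1 : s1.reg 1 = 1 := h1.reg 1 (by norm_num)
  rw [wp_cond_lt, c0]
  refine ⟨fun hlt => ?_, fun hge => ?_⟩
  · split_ifs at e1 with hm
    · refine wp_mono (wp_stepBoth h1 hm.1 hm.2.1 (by omega) (by omega)) fun s' h' => ?_
      exact ⟨_, _, h', hS.both hm, by simp only [Frame.both]; omega⟩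
    · omega
  · have hm : ¬ Meet A B f.i f.j := by
      intro hm
      rw [if_pos hm] at e1
      omega
    simp only [wp_seq, wp_add, c1, h1.r30]
    refine ⟨hw _ (by omega), ?_⟩
    refine wp_readCell (vi := f.i + 1) (vk := 1) (vj := f.j) (by simp [h1.toEnv]) (by simp)
      (by simp [c1]) (by simp [h1.r31]) (by omega) (by norm_num) (by omega) (by norm_num)
      (by norm_num) ?_
    have F1 := (h1.filled (f.i + 1) f.j (by omega) (by omega) (by omega)).threshold_left hj
    have F2 := (h1.filled f.i (f.j + 1) (by omega) (by omega) (by omega)).threshold_right hi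
    simp only [wp_seq, wp_add, State.mem_setReg, F1]
    refine ⟨by simp [h1.r31, c1]; exact hw _ (by omega), ?_⟩
    refine wp_readCell (vi := f.j + 1) (vk := 2) (vj := f.i) (by simp [h1.toEnv])
      (by simp [h1.r31, c1])
      (by simp; exact h1.reg 2 (by norm_num)) (by simp [h1.r30]) (by omega) (by norm_num)
      (by omega) (by norm_num) (by norm_num) ?_
    simp only [State.mem_setReg, F2]
    generalize hs2 : State.setReg _ 63 _ = s2
    have h2 : At A B f stk s2 := by rw [← hs2]; simp [h1]
    have e62 : s2.reg 62 = threshold A B (f.i + 1) f.j := by rw [← hs2]; simp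
    have e63 : s2.reg 63 = threshold B A (f.j + 1) f.i := by rw [← hs2]; simp
    rw [wp_cond_lt, e62, h2.r32]
    refine ⟨fun hl => ?_, fun hl => ?_⟩
    · obtain ⟨hi', hS'⟩ := hS.left hm he hl
      have hfin : ∀ stk' s', At A B f stk' s' → Search A B total out (f.left A B) stk' →
          wp (limits A B) stepLeft (fun s' => ∃ f' stk', At A B f' stk' s' ∧
            Search A B total out f' stk' ∧ f.i + f.j < f'.i + f'.j) s' := by
        intro stk' s' hA hS'
        have hle := hS'.chain.length_le
        simp only [Frame.left, List.length_append, List.length_singleton] at hle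
        refine wp_mono (wp_stepLeft hA hi' hj (by omega) (by omega)) fun s' h' => ?_
        exact ⟨_, _, h', hS', by simp only [Frame.left]; omega⟩
      rw [wp_seq, wp_cond_lt, e63, h2.r33]
      refine ⟨fun hr => ?_, fun hr => ?_⟩
      · rw [if_pos hr] at hS'
        exact wp_mono (wp_pushFrame h2 (by omega) (by omega)) fun s' h' => hfin _ s' h' hS'
      · rw [if_neg hr] at hS'
        simp only [nop, wp_move]
        exact hfin _ _ (by simp [h2]) hS'
    · obtain ⟨hj', hS'⟩ := hS.right hm he hl
      refine wp_mono (wp_stepRight h2 hi hj' (by omega) (by omega)) fun s' h' => ?_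
      exact ⟨_, _, h', hS', by simp only [Frame.right]; omega⟩

end WordRAM

namespace WordRAM

/-! ### The enumeration -/

variable {A B : List ℕ} {s : State} {f : Frame} {stk : List Frame}
  {total : List (List ℕ)}

/-- The descent from a node to a leaf of the search tree. -/
def descend : Prog :=
  .instr (.add 64 30 31) ⨾ .loop (.lt 64 23) (advance ⨾ .instr (.add 64 30 31))

theorem runs_descend {out : List (List ℕ)} (h : At A B f stk s) (hS : Search A B total out f stk) :
    Runs (limits A B) descend s (201 * (A.length + B.length + 2)) (fun s' => ∃ f' stk',
      At A B f' stk' s' ∧ Search A B total out f' stk' ∧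
        A.length + B.length ≤ f'.i + f'.j) := by
  have hi := hS.hi
  have hj := hS.hj
  refine (Runs.of_wp_le (N := 1) (Q := fun s' => At A B f stk s' ∧ s'.reg 64 = f.i + f.j)
    ?_ le_rfl).seq (N' := (A.length + B.length - (f.i + f.j)) * (200 + 1) + 1) ?_ ?_
  · simp [h, h.r30, h.r31]
    exact lt_word (by omega)
  · rintro s1 ⟨h1, h64⟩
    refine (Runs.loop (c := 200) (fun k s' => ∃ f' stk', At A B f' stk' s' ∧
      Search A B total out f' stk' ∧ s'.reg 64 = f'.i + f'.j ∧
      k = A.length + B.length - (f'.i + f'.j)) ?_ ⟨f, stk, h1, hS, h64, rfl⟩).mono le_rfl ?_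
    · rintro k s2 ⟨f2, stk2, h2, hS2, e64, rfl⟩ hb
      have c23 : s2.reg 23 = A.length + B.length := h2.reg 23 (by norm_num)
      have hb' : f2.i + f2.j < A.length + B.length := by simpa [Test.eval, c23, e64] using hb
      refine Runs.of_wp_le ?_ (show _ ≤ 200 by decide)
      rw [wp_seq]
      refine wp_mono (wp_advance h2 hS2 hb') ?_
      rintro s3 ⟨f3, stk3, h3, hS3, hlt⟩
      have hi3 := hS3.hi
      have hj3 := hS3.hj
      simp only [wp_add, h3.r30, h3.r31]
      exact ⟨lt_word (by omega), _, by omega, f3, stk3, by simp [h3], hS3, by simp, rfl⟩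
    · rintro s2 ⟨⟨k, f2, stk2, h2, hS2, e64, -⟩, hb⟩
      have c23 : s2.reg 23 = A.length + B.length := h2.reg 23 (by norm_num)
      have hb' : ¬ f2.i + f2.j < A.length + B.length := by simpa [Test.eval, c23, e64] using hb
      exact ⟨f2, stk2, h2, hS2, by omega⟩
  · have := Nat.mul_le_mul_right 201 (Nat.sub_le (A.length + B.length) (f.i + f.j))
    omega

/-- The path is written to the output. -/
def emitPath : Prog :=
  .instr (.const 65 0) ⨾ .loop (.lt 65 34)
    (readCell 61 0 10 65 ⨾ .instr (.emit 61) ⨾ .instr (.add 65 65 1))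

theorem runs_emitPath (h : At A B f stk s) (hp : f.path.length ≤ A.length + B.length)
    (hc : s.cur = []) :
    Runs (limits A B) emitPath s (21 * (A.length + B.length + 2)) (fun s' =>
      At A B f stk s' ∧ s'.cur = f.path ∧ s'.out = s.out) := by
  refine (Runs.of_wp_le (N := 1) (Q := fun s' => At A B f stk s' ∧ s'.reg 65 = 0 ∧ s'.cur = [] ∧
    s'.out = s.out) ?_ le_rfl).seq (N' := f.path.length * (20 + 1) + 1) ?_ ?_
  · simp [h, hc]
    exact lt_word (by omega)
  · rintro s1 ⟨h1, h65, hc1, ho1⟩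
    refine (Runs.loop (c := 20) (fun k s' => At A B f stk s' ∧ s'.reg 65 ≤ f.path.length ∧
      s'.cur = f.path.take (s'.reg 65) ∧ s'.out = s.out ∧ k = f.path.length - s'.reg 65) ?_
      ⟨h1, by omega, by simp [h65, hc1], ho1, by omega⟩).mono le_rfl ?_
    · rintro k s2 ⟨h2, e1, e2, e3, rfl⟩ hb
      have c0 : s2.reg 0 = 0 := h2.reg 0 (by norm_num)
      have c10 : s2.reg 10 = 10 := h2.reg 10 (by norm_num)
      have c1 : s2.reg 1 = 1 := h2.reg 1 (by norm_num)
      have hb' : s2.reg 65 < f.path.length := by simpa [Test.eval, h2.r34] using hb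
      refine Runs.of_wp_le ?_ (show _ ≤ 20 by decide)
      rw [wp_seq]
      refine wp_readCell h2.toEnv c0 c10 rfl (by omega) (by norm_num) (by omega) (by norm_num)
        (by norm_num) ?_
      rw [h2.path _ hb', wp_seq]
      refine ⟨trivial, ?_⟩
      simp only [Instr.exec, wp_add]
      simp only [State.reg_setReg, if_neg (show (65 : ℕ) ≠ 61 by norm_num), c1,
        if_neg (show (65 : ℕ) ≠ 99 by norm_num), if_neg (show (1 : ℕ) ≠ 61 by norm_num),
        if_neg (show (1 : ℕ) ≠ 99 by norm_num), if_true]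
      refine ⟨lt_word (by omega), f.path.length - (s2.reg 65 + 1), by omega, ?_, ?_, ?_, ?_, ?_⟩
      · rw [at_setReg_iff (by norm_num)]
        refine h2.of_eq (fun r hr => ?_) rfl
        simp only [State.reg_setReg]
        rw [if_neg (by omega), if_neg (by omega)]
      · simp; omega
      · simp only [State.cur_setReg, e2]
        rw [List.getD_eq_getElem _ _ hb', List.take_append_getElem]
      · simp [e3]
      · simp
    · rintro s2 ⟨⟨k, h2, e1, e2, e3, -⟩, hb⟩
      have hb' : ¬ s2.reg 65 < f.path.length := by simpa [Test.eval, h2.r34] using hb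
      refine ⟨h2, ?_, e3⟩
      rw [e2, List.take_of_length_le (by omega)]
  · have := Nat.mul_le_mul_right 21 hp
    omega

/-- The next supersequence is found and reported, and the last postponed step is taken up. -/
def nextString : Prog :=
  descend ⨾ emitPath ⨾ .instr .report ⨾
    .cond (.lt 0 35) (popFrame ⨾ stepRight) (.instr (.const 36 0))

/-- The machine is before a turn of the main loop, with `r` strings still to come. -/
def Between (A B : List ℕ) (total : List (List ℕ)) (r : ℕ) (s : State) : Prop :=
  s.reg 0 = 0 ∧ s.cur = [] ∧ total.length = s.out.length + r ∧
    (s.reg 36 = 0 ∧ s.out = total ∨ ∃ f stk, At A B f stk s ∧ Search A B total s.out f stk)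

theorem _root_.MinSuperseq.Search.length_lt {out : List (List ℕ)} (h : Search A B total out f stk) :
    out.length < total.length := by
  obtain ⟨S, hS⟩ := h.live
  have := List.length_pos_of_mem hS
  rw [h.total_eq]
  simp only [List.length_append, List.length_map]
  omega

theorem Between.halting (h : Between A B total 0 s) :
    (Test.lt 0 36).eval s = false ∧ s.out = total := by
  obtain ⟨h0, -, hl, ⟨h36, ho⟩ | ⟨f, stk, -, hS⟩⟩ := h
  · simp [Test.eval, h0, h36, ho]
  · have := hS.length_lt
    omega

theorem Between.next {r : ℕ} (h : Between A B total (r + 1) s) :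
    (Test.lt 0 36).eval s = true ∧
      Runs (limits A B) nextString s (400 * (A.length + B.length + 2)) (fun s' =>
        Between A B total r s' ∧ s'.out.length = s.out.length + 1) := by
  obtain ⟨h0, hc, hl, ⟨h36, ho⟩ | ⟨f, stk, h, hS⟩⟩ := h
  · rw [ho] at hl
    omega
  refine ⟨by simp [Test.eval, h0, h.r36], ?_⟩
  refine ((runs_descend h hS).silent (by decide)).seq
    (N' := 150 * (A.length + B.length + 2)) ?_ (by omega)
  rintro s1 ⟨⟨f1, stk1, h1, hS1, he⟩, hc1, ho1⟩
  rw [hc] at hc1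
  have hi := hS1.hi
  have hj := hS1.hj
  have hp := hS1.length_path
  refine (runs_emitPath h1 (by omega) hc1).seq (N' := 100) ?_ (by omega)
  rintro s2 ⟨h2, hc2, ho2⟩
  refine (Runs.of_wp_le (N := 1) (Q := fun s' => At A B f1 stk1 s' ∧ s'.cur = [] ∧
    s'.out = s.out ++ [f1.path]) ?_ le_rfl).seq (N' := 98) ?_ le_rfl
  · exact ⟨trivial, h2.of_eq (fun _ _ => rfl) rfl, rfl, by simp [Instr.exec, ho2, ho1, hc2]⟩
  rintro s3 ⟨h3, hc3, ho3⟩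
  have c0 : s3.reg 0 = 0 := h3.reg 0 (by norm_num)
  refine Runs.cond (N := 97) (fun hb => ?_) (fun hb => ?_) le_rfl
  · cases stk1 with
    | nil => simp [Test.eval, c0, h3.r35] at hb
    | cons g stk1 =>
      have hch := hS1.chain
      have hle := hch.length_le
      have hv := hch.2.2.1
      have hg := hv.length_path
      have hi' := hv.hi
      have hj' := hv.right_lt
      simp only [List.length_cons] at hle
      have hrun := (Runs.of_wp (L := limits A B) (p := popFrame ⨾ stepRight) (s := s3)
        (Q := At A B (g.right A B) stk1) (by
          rw [wp_seq]
          refine wp_mono (wp_popFrame h3 hch.1 (by omega)) fun s4 h4 => ?_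
          exact wp_stepRight h4 hi' hj' (by omega) (by omega))).silent (by decide)
      refine hrun.mono (by decide) ?_
      rintro s4 ⟨h4, hc4, ho4⟩
      rw [hc3] at hc4
      rw [ho3] at ho4
      have hS4 := hS1.pop he
      rw [← ho4] at hS4
      refine ⟨⟨h4.reg 0 (by norm_num), hc4, ?_, Or.inr ⟨_, _, h4, hS4⟩⟩, ?_⟩
      · rw [ho4, hl]; simp; omega
      · rw [ho4]; simp
  · cases stk1 with
    | cons g stk1 => simp [Test.eval, c0, h3.r35] at hb
    | nil =>
      have ht := hS1.total_eq_of_end he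
      simp only [List.flatMap_nil, List.append_nil] at ht
      refine Runs.of_wp_le ?_ (show _ ≤ 97 by decide)
      rw [wp_const]
      refine ⟨lt_word (by omega), ⟨by simp [c0], hc3, ?_, Or.inl ⟨by simp, ?_⟩⟩, ?_⟩
      · simp [ho3, hl]; omega
      · simp [ho3, ht]
      · simp [ho3]

/-- The search is started at the root, with limits that exclude nothing. -/
def initSearch : Prog :=
  .instr (.const 30 0) ⨾ .instr (.const 31 0) ⨾ .instr (.move 32 25) ⨾ .instr (.move 33 26) ⨾
  .instr (.const 34 0) ⨾ .instr (.const 35 0) ⨾ .instr (.const 36 1)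

theorem wp_initSearch (h : Env A B s) (hF : FilledFrom A B s.mem 0 0) :
    wp (limits A B) initSearch (At A B ⟨0, 0, A.length + 1, B.length + 1, []⟩ []) s := by
  have hw : ∀ v, v ≤ 4 * (A.length + B.length + 2) → v < (limits A B).word :=
    fun v hv => lt_word hv
  have c25 : s.reg 25 = A.length + 1 := h.reg 25 (by norm_num)
  have c26 : s.reg 26 = B.length + 1 := h.reg 26 (by norm_num)
  simp only [initSearch, wp_seq, wp_const, wp_move]
  refine ⟨hw _ (by omega), hw _ (by omega), hw _ (by omega), hw _ (by omega), hw _ (by omega), ?_⟩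
  constructor <;> simp [h, c25, c26]
  · exact hF
  · trivial

/-- Everything that precedes the main loop. -/
def preprocessing : Prog := initRegisters ⨾ fillTables ⨾ initSearch

/-- The program that enumerates the minimal common supersequences. -/
def enumerator : Prog := preprocessing ⨾ .loop (.lt 0 36) nextString

theorem runs_preprocessing (A B : List ℕ) :
    Runs (limits A B) preprocessing (State.init A B) (900 * (A.length + B.length + 2) ^ 3)
      (fun s' => s'.out = [] ∧ Between A B (completions A B 0 0 (A.length + 1) (B.length + 1))
        (completions A B 0 0 (A.length + 1) (B.length + 1)).length s') := by
  have hN : 2 ^ 3 ≤ (A.length + B.length + 2) ^ 3 := Nat.pow_le_pow_left (by omega) 3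
  have h : Runs (limits A B) preprocessing (State.init A B) (900 * (A.length + B.length + 2) ^ 3)
      (At A B ⟨0, 0, A.length + 1, B.length + 1, []⟩ []) := by
    refine runs_initRegisters.seq (N' := 1 + 800 * (A.length + B.length + 2) ^ 3 + 14)
      (fun s1 h1 => ?_) (by omega)
    refine (runs_fillTables h1).seq (N' := 14) (fun s2 h2 => ?_) (by omega)
    exact Runs.of_wp_le (wp_initSearch h2.1 h2.2) (by decide)
  refine (h.silent (by decide)).mono le_rfl ?_
  rintro s ⟨h, hc, ho⟩
  have ho' : s.out = [] := ho
  have hS := Search.start A B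
  rw [← ho'] at hS
  exact ⟨ho', h.reg 0 (by norm_num), hc, by simp [ho'], Or.inr ⟨_, _, h, hS⟩⟩

/-- The initial memory holds lengths and symbols only. -/
theorem fits_init (A B : List ℕ) : (State.init A B).Fits (limits A B) := by
  have hw : ∀ v, v ≤ 4 * (A.length + B.length + 2) → v < (limits A B).word :=
    fun v hv => lt_word hv
  intro i
  refine ⟨Or.inl (hw _ (by simp [State.init])), ?_⟩
  match i with
  | 0 => exact Or.inl (hw _ (by simp [State.init]; omega))
  | 1 => exact Or.inl (hw _ (by simp [State.init]; omega))
  | i + 2 =>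
    by_cases hi : i < (A ++ B).length
    · right
      have : (State.init A B).mem (i + 2) = (A ++ B)[i] := by
        simp [State.init, List.getElem?_eq_getElem hi]
      rw [this]
      exact List.getElem_mem hi
    · left
      have : (State.init A B).mem (i + 2) = 0 := by
        simp [State.init, List.getElem?_eq_none (not_lt.1 hi)]
      rw [this]
      exact hw _ (by omega)

end WordRAM

open WordRAM in
theorem mainTheorem1 :
    ∃ (P : WordRAM.Prog) (C : ℕ), ∀ A B : List ℕ,
      P.Enumerates A B (IsMinimalCommonSupersequence A B) ∧
      P.PreprocessingAndDelay A B
        (C * (A.length + B.length + 1) ^ 3) (C * (A.length + B.length + 1)) ∧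
      P.SpaceWithin A B (C * (A.length + B.length + 1) ^ 2) ∧
      P.WordsWithin A B ((A.length + B.length + 2) ^ C) := by
  -- The constant has to bound the factors of the preprocessing time, `900 * 2 ^ 3`, of the delay,
  -- `2 * (400 * 2 + 1)`, and of the space, `16 * 2 ^ 2`, where `n + 2 ≤ 2 * (n + 1)` is used.
  obtain ⟨C, hC⟩ : ∃ C, C = 10000 := ⟨_, rfl⟩
  refine ⟨enumerator, C, fun A B => ?_⟩
  obtain ⟨n₀, hn₀, s₁, he₁, ho₁, hb₁⟩ := runs_preprocessing A B
  obtain ⟨n₁, s₂, he₂, hb₂⟩ := exec_of_loop (L := limits A B) (b := .lt 0 36) (p := nextString)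
    (Between A B (completions A B 0 0 (A.length + 1) (B.length + 1)))
    (fun _ h => h.halting.1)
    (fun _ _ h => ⟨h.next.1, h.next.2.mono le_rfl fun _ h => h.1⟩) hb₁
  have hf₀ := fits_init A B
  obtain ⟨hf₁, hr₁⟩ := he₁.sound hf₀
  obtain ⟨hf₂, hr⟩ := (Exec.seq he₁ he₂).sound hf₀
  have hr := hr []
  -- the run from the end of the preprocessing on
  have hstart : ∀ t, enumerator.run A B (t + (n₀ + 1)) =
      Config.step^[t] ⟨[.loop (.lt 0 36) nextString], s₁⟩ := by
    intro t
    rw [Prog.run, Function.iterate_add_apply, Function.iterate_succ_apply]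
    have : Config.step ⟨[enumerator], State.init A B⟩ =
      ⟨[preprocessing, .loop (.lt 0 36) nextString], State.init A B⟩ := rfl
    rw [this, (hr₁ _).1]
  -- the machine respects the limits, also after it has halted
  have hsafe : ∀ t, (enumerator.run A B t).Safe (limits A B) := by
    intro t
    by_cases ht : t < n₀ + n₁ + 1
    · exact hr.2 t ht
    · obtain ⟨d, rfl⟩ := Nat.exists_eq_add_of_le' (not_lt.1 ht)
      rw [Prog.run, Function.iterate_add_apply]
      have e := hr.1
      rw [show Config.mk [enumerator] (State.init A B) =
        ⟨[preprocessing ⨾ .loop (.lt 0 36) nextString], State.init A B⟩ from rfl, e,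
        step_halted (by exact rfl)]
      exact ⟨by simp [Config.address], hf₂⟩
  refine ⟨⟨n₀ + n₁ + 1, ?_⟩, ⟨n₀ + 1, ?_, ?_⟩, ?_, ?_⟩
  · have e : enumerator.run A B (n₀ + n₁ + 1) = ⟨[], s₂⟩ := hr.1
    rw [e]
    refine ⟨rfl, hb₂.2.1, ?_, fun S => ?_⟩
    · simp only [hb₂.halting.2]
      exact completions_nodup _ _ _ _ _ _
    · simp only [hb₂.halting.2]
      exact mem_completions_start_iff A B S
  · have h3 : (A.length + B.length + 2) ^ 3 ≤ (2 * (A.length + B.length + 1)) ^ 3 :=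
      Nat.pow_le_pow_left (by omega) 3
    rw [Nat.mul_pow] at h3
    have h1 : 1 ^ 3 ≤ (A.length + B.length + 1) ^ 3 := Nat.pow_le_pow_left (by omega) 3
    rw [hC]
    omega
  · have e := hstart 0
    rw [Nat.zero_add] at e
    rw [e]
    refine ⟨hb₁.2.1, ho₁, fun t ht => ?_⟩
    obtain ⟨t, rfl⟩ := Nat.exists_eq_add_of_le' ht
    have hd := delay_of_loop (L := limits A B) (b := .lt 0 36) (p := nextString)
      (Between A B (completions A B 0 0 (A.length + 1) (B.length + 1)))
      (fun _ h => h.halting.1) (fun _ _ h => h.next) hb₁ hf₁ t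
    obtain ⟨k, hk⟩ := Nat.exists_eq_add_of_le (show
      2 * (400 * (A.length + B.length + 2) + 1) ≤ C * (A.length + B.length + 1) by rw [hC]; omega)
    rw [hk, show ∀ D, t + (n₀ + 1) + (D + k) = (t + D + k) + (n₀ + 1) by intro D; omega, hstart,
      hstart]
    rcases hd with hd | hd
    · exact Or.inl (hd.trans_le (out_length_mono _ (by omega)))
    · right
      rw [show ∀ D, t + D + k = k + (t + D) by intro D; omega, Function.iterate_add_apply,
        step_halted hd]
      exact hd
  · intro t a ha
    refine ((hsafe t).1 a ha).trans_le ?_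
    have h2 : (A.length + B.length + 2) ^ 2 ≤ (2 * (A.length + B.length + 1)) ^ 2 :=
      Nat.pow_le_pow_left (by omega) 2
    rw [Nat.mul_pow] at h2
    simp only [limits, hC]
    omega
  · intro t i
    have hw : (limits A B).word ≤ (A.length + B.length + 2) ^ C :=
      Nat.pow_le_pow_right (by omega) (by omega)
    exact ⟨((hsafe t).2 i).1.imp_left (fun h => h.trans_le hw),
      ((hsafe t).2 i).2.imp_left (fun h => h.trans_le hw)⟩
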